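/- Let $X$ be a complex Banach space and let $T$ be a bounded linear operator on $X$. **Operators on a complex Banach space $Y$.** For a bounded linear operator $S$ on $Y$ let $\alpha(S)=\dim\ker S$ and $\beta(S)=\operatorname{codim}S(Y)$. $S$ is *upper* (resp. *lower*) *semi-Fredholm* if $S(Y)$ is closed and $\alpha(S)<\infty$ (resp. $\beta(S)<\infty$), *semi-Fredholm* if it is one of the two, and *Fredholm* if it is both; for semi-Fredholm $S$ put $\operatorname{ind}(S)=\alpha(S)-\beta(S)\in[-\infty,\infty]$. The ascent $p(S)$ and the descent $q(S)$ are the least $n\ge 0$ with $\ker S^n=\ker S^{n+1}$, resp. $S^n(Y)=S^{n+1}(Y)$ ($\infty$ if there is none). $S$ is *Weyl* if it is Fredholm with $\operatorname{ind}(S)=0$; *upper semi-Weyl* if it is upper semi-Fredholm with $\operatorname{ind}(S)\le 0$; *Browder* if it is Fredholm with $p(S)<\infty$ and $q(S)<\infty$; *upper semi-Browder* if it is upper semi-Fredholm with $p(S)<\infty$; *bounded below* if it is injective with closed range; *semi-regular* if $S(Y)$ is closed and $\ker S\subset S^n(Y)$ for all $n$; *zeroloid* if the spectrum of $S$ has no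 accumulation point other than possibly $0$. **Decompositions.** Write $(M,N)\in\operatorname{Red}(T)$ if $M,N$ are closed $T$-invariant subspaces with $X=M\oplus N$, and let $T_M,T_N$ be the restrictions of $T$ to $M,N$. $T$ is *$g_z$-Fredholm* (resp. *upper semi-$g_z$-Fredholm*, *semi-$g_z$-Fredholm*) if there is $(M,N)\in\operatorname{Red}(T)$ with $T_M$ Fredholm (resp. upper semi-Fredholm, semi-Fredholm) and $T_N$ zeroloid. The index of a semi-$g_z$-Fredholm $T$ is $\operatorname{ind}(T_M)$ for any $(M,N)\in\operatorname{Red}(T)$ with $T_M$ semi-Fredholm and $T_N$ zeroloid. $T$ is *$g_z$-Weyl* if it is $g_z$-Fredholm of index $0$, and *upper semi-$g_z$-Weyl* if it is upper semi-$g_z$-Fredholm of index $\le 0$. $T$ is *left* (resp. *right*) *$g_z$-invertible* if there is $(M,N)\in\operatorname{Red}(T)$ with $T_M$ semi-regular, $T_N$ zeroloid, and $T_M$ bounded below (resp. surjective); it is *$g_z$-invertible* if it is both left and right $g_z$-invertible. **Spectra.** For each class of operators, the corresponding spectrum of $T$ is the set of $\lambda\in\mathbb C$ such that $T-\lambda I$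 is not in the class: $\sigma_w,\sigma_{uw},\sigma_e,\sigma_b,\sigma_{ub}$ for Weyl, upper semi-Weyl, Fredholm, Browder, upper semi-Browder operators; $\sigma_{g_zw},\sigma_{ug_zw},\sigma_{g_zf},\sigma_{g_zd},\sigma_{lg_zd}$ for $g_z$-Weyl, upper semi-$g_z$-Weyl, $g_z$-Fredholm, $g_z$-invertible, left $g_z$-invertible operators. $T$ satisfies *Browder's theorem* if $\sigma_w(T)=\sigma_b(T)$, *essential Browder's theorem* if $\sigma_e(T)=\sigma_b(T)$, and *a-Browder's theorem* if $\sigma_{uw}(T)=\sigma_{ub}(T)$. **Theorem 4.1.** 1. $T$ satisfies Browder's theorem if and only if $\sigma_{g_zw}(T)=\sigma_{g_zd}(T)$. 2. $T$ satisfies essential Browder's theorem if and only if $\sigma_{g_zf}(T)=\sigma_{g_zd}(T)$. 3. $T$ satisfies a-Browder's theorem if and only if $\sigma_{ug_zw}(T)=\sigma_{lg_zd}(T)$. -/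

import Mathlib

open scoped ENNReal

noncomputable section

namespace GzSpectral

/-! ### Single operators on a normed space

`T.ker` and `T.range` are the kernel and the range of `T`. -/

section Operators

variable {Y : Type*} [NormedAddCommGroup Y] [NormedSpace ℂ Y]

/-- `α(T)`: the dimension of the kernel, `⊤` if it is infinite. -/
def nullity (T : Y →L[ℂ] Y) : ℕ∞ := Cardinal.toENat (Module.rank ℂ T.ker)

/-- `β(T)`: the (algebraic) codimension of the range, `⊤` if it is infinite. -/
def defect (T : Y →L[ℂ] Y) : ℕ∞ := Cardinal.toENat (Module.rank ℂ (Y ⧸ T.range))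

/-- `ind(T) = α(T) - β(T)` in `[-∞, ∞]`; only used when `α(T)` or `β(T)` is finite. -/
def ind (T : Y →L[ℂ] Y) : EReal :=
  (((nullity T : ℕ∞) : ℝ≥0∞) : EReal) - (((defect T : ℕ∞) : ℝ≥0∞) : EReal)

/-- The ascent `p(T)`, the least `n` with `N(Tⁿ) = N(Tⁿ⁺¹)`; `⊤` if there is none. -/
def ascent (T : Y →L[ℂ] Y) : ℕ∞ :=
  sInf {k : ℕ∞ | ∃ n : ℕ, k = n ∧ (T ^ n).ker = (T ^ (n + 1)).ker}

/-- The descent `q(T)`, the least `n` with `R(Tⁿ) = R(Tⁿ⁺¹)`; `⊤` if there is none. -/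
def descent (T : Y →L[ℂ] Y) : ℕ∞ :=
  sInf {k : ℕ∞ | ∃ n : ℕ, k = n ∧ (T ^ n).range = (T ^ (n + 1)).range}

/-- Upper semi-Fredholm: closed range and finite-dimensional kernel. -/
def IsUpperSemiFredholm (T : Y →L[ℂ] Y) : Prop :=
  IsClosed (T.range : Set Y) ∧ nullity T < ⊤

/-- Lower semi-Fredholm: closed range of finite codimension. -/
def IsLowerSemiFredholm (T : Y →L[ℂ] Y) : Prop :=
  IsClosed (T.range : Set Y) ∧ defect T < ⊤

def IsSemiFredholm (T : Y →L[ℂ] Y) : Prop :=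
  IsUpperSemiFredholm T ∨ IsLowerSemiFredholm T

/-- Weyl: Fredholm of index zero. -/
def IsWeyl (T : Y →L[ℂ] Y) : Prop := T.IsFredholm ∧ ind T = 0

/-- Upper semi-Weyl: upper semi-Fredholm with `ind(T) ≤ 0`. -/
def IsUpperSemiWeyl (T : Y →L[ℂ] Y) : Prop := IsUpperSemiFredholm T ∧ ind T ≤ 0

/-- Browder: Fredholm of finite ascent and finite descent. -/
def IsBrowder (T : Y →L[ℂ] Y) : Prop := T.IsFredholm ∧ ascent T < ⊤ ∧ descent T < ⊤

/-- Upper semi-Browder: upper semi-Fredholm of finite ascent. -/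
def IsUpperSemiBrowder (T : Y →L[ℂ] Y) : Prop := IsUpperSemiFredholm T ∧ ascent T < ⊤

/-- Bounded below: injective with closed range. -/
def IsBoundedBelow (T : Y →L[ℂ] Y) : Prop := IsUpperSemiFredholm T ∧ nullity T = 0

/-- Semi-regular: closed range, and the kernel is contained in the range of every power. -/
def IsSemiRegular (T : Y →L[ℂ] Y) : Prop :=
  IsClosed (T.range : Set Y) ∧ ∀ n : ℕ, T.ker ≤ (T ^ n).range

/-- Zeroloid: the spectrum has no accumulation point other than (possibly) `0`. -/
def IsZeroloid (T : Y →L[ℂ] Y) : Prop := derivedSet (spectrum ℂ T) ⊆ {0}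

/-- The spectrum attached to a class `P` of operators: all `z` with `T - z I` not in `P`. -/
def spectrumOf (P : (Y →L[ℂ] Y) → Prop) (T : Y →L[ℂ] Y) : Set ℂ :=
  {z | ¬ P (T - z • (1 : Y →L[ℂ] Y))}

end Operators

/-! ### Decompositions `X = M ⊕ N` that reduce `T` -/

section Decompositions

variable {X : Type*} [NormedAddCommGroup X] [NormedSpace ℂ X]

/-- `(M, N) ∈ Red(T)`: `M`, `N` are closed `T`-invariant subspaces and `X = M ⊕ N`.
The restrictions `T_M` and `T_N` are `T.restrict h.invariant_left`,
`T.restrict h.invariant_right`. -/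
structure IsRed (T : X →L[ℂ] X) (M N : Submodule ℂ X) : Prop where
  isClosed_left : IsClosed (M : Set X)
  isClosed_right : IsClosed (N : Set X)
  invariant_left : ∀ x ∈ M, T x ∈ M
  invariant_right : ∀ x ∈ N, T x ∈ N
  isCompl : IsCompl M N

/-- `T` is upper semi-`g_z`-Fredholm. -/
def IsUpperSemiGzFredholm (T : X →L[ℂ] X) : Prop :=
  ∃ (M N : Submodule ℂ X) (h : IsRed T M N),
    IsUpperSemiFredholm (T.restrict h.invariant_left) ∧
      IsZeroloid (T.restrict h.invariant_right)

/-- `T` is `g_z`-Fredholm. -/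
def IsGzFredholm (T : X →L[ℂ] X) : Prop :=
  ∃ (M N : Submodule ℂ X) (h : IsRed T M N),
    (T.restrict h.invariant_left).IsFredholm ∧ IsZeroloid (T.restrict h.invariant_right)

/-- `k` is the index of the semi-`g_z`-Fredholm operator `T`: the index of `T_M` for
some `(M, N) ∈ Red(T)` with `T_M` semi-Fredholm and `T_N` zeroloid. -/
def HasGzIndex (T : X →L[ℂ] X) (k : EReal) : Prop :=
  ∃ (M N : Submodule ℂ X) (h : IsRed T M N),
    IsSemiFredholm (T.restrict h.invariant_left) ∧
      IsZeroloid (T.restrict h.invariant_right) ∧ ind (T.restrict h.invariant_left) = k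

/-- `g_z`-Weyl: `g_z`-Fredholm of index zero. -/
def IsGzWeyl (T : X →L[ℂ] X) : Prop := IsGzFredholm T ∧ HasGzIndex T 0

/-- Upper semi-`g_z`-Weyl: upper semi-`g_z`-Fredholm of index at most zero. -/
def IsUpperSemiGzWeyl (T : X →L[ℂ] X) : Prop :=
  IsUpperSemiGzFredholm T ∧ ∃ k : EReal, HasGzIndex T k ∧ k ≤ 0

/-- `(M, N) ∈ g_zKD(T)`: a generalized Kato zeroloid decomposition of `T`. -/
structure IsGzKD (T : X →L[ℂ] X) (M N : Submodule ℂ X) : Prop extends IsRed T M N where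
  semiRegular_left : IsSemiRegular (T.restrict invariant_left)
  zeroloid_right : IsZeroloid (T.restrict invariant_right)

/-- `T` is left `g_z`-invertible. -/
def IsLeftGzInvertible (T : X →L[ℂ] X) : Prop :=
  ∃ (M N : Submodule ℂ X) (h : IsGzKD T M N), IsBoundedBelow (T.restrict h.invariant_left)

/-- `T` is right `g_z`-invertible. -/
def IsRightGzInvertible (T : X →L[ℂ] X) : Prop :=
  ∃ (M N : Submodule ℂ X) (h : IsGzKD T M N),
    Function.Surjective (T.restrict h.invariant_left)

/-- `T` is `g_z`-invertible: left and right `g_z`-invertible. -/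
def IsGzInvertible (T : X →L[ℂ] X) : Prop := IsLeftGzInvertible T ∧ IsRightGzInvertible T

end Decompositions

/-! ### The three Browder-type theorems for a given operator -/

section BrowderTheorems

variable {X : Type*} [NormedAddCommGroup X] [NormedSpace ℂ X]

/-- `T ∈ (B)`: the Weyl spectrum equals the Browder spectrum. -/
def SatisfiesBrowder (T : X →L[ℂ] X) : Prop :=
  spectrumOf IsWeyl T = spectrumOf IsBrowder T

/-- `T ∈ (B_e)`: the essential (Fredholm) spectrum equals the Browder spectrum. -/
def SatisfiesEssentialBrowder (T : X →L[ℂ] X) : Prop :=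
  spectrumOf ContinuousLinearMap.IsFredholm T = spectrumOf IsBrowder T

/-- `T ∈ (aB)`: the upper semi-Weyl spectrum equals the upper semi-Browder spectrum. -/
def SatisfiesABrowder (T : X →L[ℂ] X) : Prop :=
  spectrumOf IsUpperSemiWeyl T = spectrumOf IsUpperSemiBrowder T

end BrowderTheorems

end GzSpectral

end

open GzSpectral

/-!
Upper semi-Fredholm operators form an open set on which the index is locally constant. So if
`S = S_M ⊕ S_N` with `S_M` upper semi-Fredholm and `S_N` zeroloid, then for arbitrarily small `w`
the operator `S_N - w` is invertible and `S - w` is upper semi-Fredholm with the index of `S_M`.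
Given an equality of classical spectra, these `S - w` have finite ascent, hence so do the `S_M - w`,
and this passes to `S_M`: its restriction to the intersection of the ranges of its powers is
surjective, so of index `≥ 0`, while finite ascent of a small perturbation makes the index `≤ 0`;
the restriction is therefore injective, which means finite ascent. Finally, an upper semi-Fredholm
operator of finite ascent is the sum of a bounded below operator and one on a finite-dimensional
space, and the latter is absorbed into the zeroloid part. The converse uses the same
perturbations, and the three equivalences are the cases where the index is required to lie in
`{0}`, in `{⊥}ᶜ` and in `Set.Iic 0`.
-/

namespace GzSpectral

open Filter Topology

universe u

section Codimension

variable {𝕜 : Type*} {E F : Type u} [DivisionRing 𝕜] [AddCommGroup E] [Module 𝕜 E] [AddCommGroup F]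
  [Module 𝕜 F]

/-- The codimension of a subspace, `⊤` if it is infinite. -/
noncomputable def codim (Z : Submodule 𝕜 E) : ℕ∞ := Cardinal.toENat (Module.rank 𝕜 (E ⧸ Z))

lemma codim_lt_top {Z : Submodule 𝕜 E} : codim Z < ⊤ ↔ FiniteDimensional 𝕜 (E ⧸ Z) := by
  rw [codim, Cardinal.toENat_lt_top, Module.rank_lt_aleph0_iff]

lemma codim_eq_zero {Z : Submodule 𝕜 E} : codim Z = 0 ↔ Z = ⊤ := by
  rw [codim, Cardinal.toENat_eq_zero, rank_zero_iff, Submodule.Quotient.subsingleton_iff]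

lemma codim_eq_of_isCompl {Z G : Submodule 𝕜 E} (h : IsCompl Z G) :
    codim Z = Cardinal.toENat (Module.rank 𝕜 G) := by
  rw [codim, (Submodule.quotientEquivOfIsCompl Z G h).rank_eq]

lemma rank_le_codim {Z G : Submodule 𝕜 E} (h : Disjoint Z G) :
    Cardinal.toENat (Module.rank 𝕜 G) ≤ codim Z := by
  refine OrderHomClass.mono _ (LinearMap.rank_le_of_injective (Z.mkQ ∘ₗ G.subtype) ?_)
  rw [← LinearMap.ker_eq_bot, LinearMap.ker_comp, Submodule.ker_mkQ,
    ← Submodule.disjoint_iff_comap_eq_bot]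
  exact h.symm

lemma le_codim_iff {Z : Submodule 𝕜 E} {n : ℕ} :
    n ≤ codim Z ↔ ∃ f : (Fin n → 𝕜) →ₗ[𝕜] E, Function.Injective f ∧ Disjoint Z f.range := by
  constructor
  · intro h
    obtain ⟨G, hG⟩ := Submodule.exists_isCompl Z
    rw [codim_eq_of_isCompl hG, Cardinal.natCast_le_toENat,
      Module.le_rank_iff_exists_linearMap] at h
    obtain ⟨f, hf⟩ := h
    exact ⟨G.subtype ∘ₗ f, G.injective_subtype.comp hf,
      hG.disjoint.mono_right ((LinearMap.range_comp_le_range _ _).trans G.range_subtype.le)⟩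
  · rintro ⟨f, hf, hd⟩
    refine le_trans ?_ (rank_le_codim hd)
    rw [Cardinal.natCast_le_toENat, Module.le_rank_iff_exists_linearMap]
    exact ⟨f.rangeRestrict, (LinearEquiv.ofInjective f hf).injective⟩

lemma exists_rank_ker_add (f : E →ₗ[𝕜] F) {Z : Submodule 𝕜 E} (hd : Disjoint f.ker Z) :
    ∃ r : ℕ∞, Cardinal.toENat (Module.rank 𝕜 f.ker) + r = codim Z ∧
      codim f.range + r = codim (Z.map f) := by
  let φ := Z.mapQ (Z.map f) f (Submodule.le_comap_map _ _)
  refine ⟨Cardinal.toENat (Module.rank 𝕜 φ.range), ?_, ?_⟩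
  · have hinj : Function.Injective (Z.mkQ.domRestrict f.ker) := by
      rwa [← LinearMap.ker_eq_bot, LinearMap.ker_domRestrict, Submodule.ker_mkQ,
        ← Submodule.disjoint_iff_comap_eq_bot]
    have hker : φ.ker = f.ker.map Z.mkQ := by
      rw [Submodule.ker_mapQ, Submodule.comap_map_eq, Submodule.map_sup, Submodule.mkQ_map_self,
        bot_sup_eq]
    have hrange : (Z.mkQ.domRestrict f.ker).range = φ.ker := by
      rw [LinearMap.range_domRestrict, hker]
    rw [← rank_range_of_injective _ hinj, hrange, codim, ← map_add, add_comm,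
      LinearMap.rank_range_add_rank_ker]
  · have hrange : φ.range = f.range.map (Z.map f).mkQ := Submodule.range_mapQ ..
    have e : ((F ⧸ Z.map f) ⧸ φ.range) ≃ₗ[𝕜] F ⧸ f.range :=
      (Submodule.quotEquivOfEq _ _ hrange).trans
        (Submodule.quotientQuotientEquivQuotient _ _ LinearMap.map_le_range)
    rw [codim, ← e.rank_eq, ← map_add, Submodule.rank_quotient_add_rank, codim]

lemma codim_map_equiv (e : E ≃ₗ[𝕜] F) (Z : Submodule 𝕜 E) :
    codim (Z.map e.toLinearMap) = codim Z := by
  rw [codim, codim, (Submodule.Quotient.equiv Z _ e rfl).rank_eq]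

lemma rank_submodule_prod (P : Submodule 𝕜 E) (Q : Submodule 𝕜 F) :
    Module.rank 𝕜 (P.prod Q) = Module.rank 𝕜 P + Module.rank 𝕜 Q := by
  rw [← rank_prod', ← rank_range_of_injective (P.subtype.prodMap Q.subtype)
    (P.injective_subtype.prodMap Q.injective_subtype), LinearMap.range_prodMap,
    P.range_subtype, Q.range_subtype]

lemma codim_prod (P : Submodule 𝕜 E) (Q : Submodule 𝕜 F) :
    codim (P.prod Q) = codim P + codim Q := by
  have hker : (P.mkQ.prodMap Q.mkQ).ker = P.prod Q := by
    rw [LinearMap.ker_prodMap, P.ker_mkQ, Q.ker_mkQ]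
  have e := (P.mkQ.prodMap Q.mkQ).quotKerEquivOfSurjective
    (P.mkQ_surjective.prodMap Q.mkQ_surjective)
  rw [codim, ← hker, e.rank_eq, rank_prod', map_add, codim, codim]

end Codimension

section Perturbation

variable {𝕜 E F G : Type*} [NontriviallyNormedField 𝕜]
  [NormedAddCommGroup E] [NormedSpace 𝕜 E] [NormedAddCommGroup F] [NormedSpace 𝕜 F]
  [NormedAddCommGroup G] [NormedSpace 𝕜 G]

lemma injective_coprod_iff {R : E →L[𝕜] F} {j : G →L[𝕜] F} :
    Function.Injective (R.coprod j) ↔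
      Function.Injective R ∧ Function.Injective j ∧ Disjoint R.range j.range := by
  constructor
  · refine fun h ↦ ⟨fun x y hxy ↦ ?_, fun x y hxy ↦ ?_, ?_⟩
    · exact congrArg Prod.fst (@h (x, 0) (y, 0) (by simpa using hxy))
    · exact congrArg Prod.snd (@h (0, x) (0, y) (by simpa using hxy))
    · rw [Submodule.disjoint_def]
      rintro _ ⟨x, rfl⟩ ⟨y, hy : j y = R x⟩
      have hx : x = 0 := congrArg Prod.fst (@h (x, -y) (0, 0) (by simp [hy]))
      simp [hx]
  · rintro ⟨hR, hj, hd⟩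
    have h := LinearMap.ker_coprod_of_disjoint_range R.toLinearMap j.toLinearMap hd
    rw [LinearMap.ker_eq_bot.2 hR, LinearMap.ker_eq_bot.2 hj, Submodule.prod_bot] at h
    exact LinearMap.ker_eq_bot.1 h

lemma continuous_coprod_left (j : G →L[𝕜] F) : Continuous fun R : E →L[𝕜] F ↦ R.coprod j := by
  have h : (fun R : E →L[𝕜] F ↦ R.coprod j) = fun R ↦
      R ∘L ContinuousLinearMap.fst 𝕜 E G + j ∘L ContinuousLinearMap.snd 𝕜 E G := by
    ext <;> simp
  rw [h]
  fun_prop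

variable [CompleteSpace E] [CompleteSpace F]

lemma eventually_injective_isClosed_range {R : E →L[𝕜] F} (hi : Function.Injective R)
    (hc : IsClosed (Set.range R)) :
    ∀ᶠ R' : E →L[𝕜] F in 𝓝 R, Function.Injective R' ∧ IsClosed (Set.range R') := by
  obtain ⟨K, hK⟩ := R.antilipschitz_of_injective_of_isClosed_range hi hc
  have hK' : AntilipschitzWith (K + 1) R := fun x y ↦ (hK x y).trans (by gcongr; simp)
  filter_upwards [Metric.ball_mem_nhds R (ε := ((K + 1)⁻¹ : NNReal)) (by positivity)] with R' hR'
  have hlt : ‖R' - R‖₊ < (K + 1)⁻¹ := by exact_mod_cast mem_ball_iff_norm.1 hR'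
  have h := hK'.add_lipschitzWith (R' - R).lipschitz hlt
  simp only [sub_apply, add_sub_cancel] at h
  exact ⟨h.injective, h.isClosed_range R'.uniformContinuous⟩

lemma eventually_bijective {R : E →L[𝕜] F} (h : Function.Bijective R) :
    ∀ᶠ R' : E →L[𝕜] F in 𝓝 R, Function.Bijective R' := by
  let e := ContinuousLinearEquiv.ofBijective R (LinearMap.ker_eq_bot.2 h.1)
    (LinearMap.range_eq_top.2 h.2)
  have he : (e : E →L[𝕜] F) = R := ContinuousLinearEquiv.coe_ofBijective ..
  filter_upwards [he ▸ e.nhds]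
  rintro _ ⟨e', rfl⟩
  exact e'.bijective

lemma eventually_surjective {R : E →L[𝕜] F} (hR : Function.Surjective R) :
    ∀ᶠ R' : E →L[𝕜] F in 𝓝 R, Function.Surjective R' := by
  obtain ⟨g, hg⟩ := R.exists_nonlinearRightInverse_of_surjective (LinearMap.range_eq_top.2 hR)
  filter_upwards [Metric.ball_mem_nhds R (inv_pos.2 (NNReal.coe_pos.2 hg))] with R' hR' y
  have happ : ApproximatesLinearOn R' R Set.univ ‖R' - R‖₊ := fun x _ z _ ↦ by
    rw [show R' x - R' z - R (x - z) = (R' - R) (x - z) by simp]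
    exact (R' - R).le_opNorm _
  have hδ : 0 < (g.nnnorm : ℝ)⁻¹ - ‖R' - R‖₊ := sub_pos.2 (mem_ball_iff_norm.1 hR')
  have h := happ.surjOn_closedBall_of_nonlinearRightInverse g (b := 0)
    (ε := ‖y‖ / ((g.nnnorm : ℝ)⁻¹ - ‖R' - R‖₊)) (by positivity) (Set.subset_univ _)
  obtain ⟨x, -, hx⟩ := h (show y ∈ _ by
    rw [mem_closedBall_iff_norm, map_zero, sub_zero, mul_div_cancel₀ _ hδ.ne'])
  exact ⟨x, hx⟩

variable [CompleteSpace 𝕜]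

lemma eventually_le_codim_range {R : E →L[𝕜] F} (hi : Function.Injective R)
    (hc : IsClosed (Set.range R)) {n : ℕ} (hn : n ≤ codim R.range) :
    ∀ᶠ R' : E →L[𝕜] F in 𝓝 R, n ≤ codim R'.range := by
  obtain ⟨f, hf, hd⟩ := le_codim_iff.1 hn
  let j : (Fin n → 𝕜) →L[𝕜] F := f.toContinuousLinearMap
  have hcl : IsClosed (Set.range (R.coprod j)) := by
    have := Submodule.isClosed_sup_finiteDimensional R.range j.range hc
    rwa [← ContinuousLinearMap.range_coprod] at this
  have hev := eventually_injective_isClosed_range (injective_coprod_iff.2 ⟨hi, hf, hd⟩) hcl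
  filter_upwards [(continuous_coprod_left j).continuousAt.eventually hev] with R' hR'
  exact le_codim_iff.2 ⟨f, (injective_coprod_iff.1 hR'.1).2⟩

lemma eventually_codim_range_eq_of_lt_top {R : E →L[𝕜] F} (hi : Function.Injective R)
    (hf : codim R.range < ⊤) : ∀ᶠ R' : E →L[𝕜] F in 𝓝 R, codim R'.range = codim R.range := by
  obtain ⟨G, hG⟩ := Submodule.exists_isCompl R.range
  have hfin : FiniteDimensional 𝕜 G :=
    have := codim_lt_top.1 hf
    (Submodule.quotientEquivOfIsCompl _ _ hG).finiteDimensional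
  have : CompleteSpace G := FiniteDimensional.complete 𝕜 G
  have hiff (R' : E →L[𝕜] F) : Function.Bijective (R'.coprod G.subtypeL) ↔
      Function.Injective R' ∧ IsCompl R'.range G := by
    have hrG : G.subtypeL.range = G := G.range_subtype
    have hs : Function.Surjective (R'.coprod G.subtypeL) ↔ Codisjoint R'.range G := by
      have h : (R'.coprod G.subtypeL).range = R'.range ⊔ G := by
        rw [ContinuousLinearMap.range_coprod, hrG]
      rw [codisjoint_iff, ← h]
      exact LinearMap.range_eq_top.symm
    rw [Function.Bijective, injective_coprod_iff, hs, hrG, isCompl_iff]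
    have := G.injective_subtype
    tauto
  have hev := eventually_bijective ((hiff R).2 ⟨hi, hG⟩)
  filter_upwards [(continuous_coprod_left G.subtypeL).continuousAt.eventually hev] with R' hR'
  rw [codim_eq_of_isCompl hG, codim_eq_of_isCompl ((hiff R').1 hR').2]

end Perturbation

lemma eventually_codim_range_eq {𝕜 E F : Type*} [RCLike 𝕜]
    [NormedAddCommGroup E] [NormedSpace 𝕜 E] [CompleteSpace E]
    [NormedAddCommGroup F] [NormedSpace 𝕜 F] [CompleteSpace F] {R : E →L[𝕜] F}
    (hi : Function.Injective R) (hc : IsClosed (Set.range R)) :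
    ∀ᶠ R' : E →L[𝕜] F in 𝓝 R, codim R'.range = codim R.range := by
  obtain hf | hf := lt_or_eq_of_le (le_top : codim R.range ≤ ⊤)
  · exact eventually_codim_range_eq_of_lt_top hi hf
  let inj : Set (E →L[𝕜] F) := {R' | Function.Injective R' ∧ IsClosed (Set.range R')}
  let u (n : ℕ) : Set (E →L[𝕜] F) := {R' | R' ∈ inj ∧ (n + 1 : ℕ) ≤ codim R'.range}
  let v (n : ℕ) : Set (E →L[𝕜] F) := {R' | R' ∈ inj ∧ codim R'.range ≤ n}
  have hu (n : ℕ) : IsOpen (u n) := isOpen_iff_mem_nhds.2 fun R' hR' ↦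
    (eventually_injective_isClosed_range hR'.1.1 hR'.1.2).and
      (eventually_le_codim_range hR'.1.1 hR'.1.2 hR'.2)
  have hv (n : ℕ) : IsOpen (v n) := isOpen_iff_mem_nhds.2 fun R' hR' ↦
    (eventually_injective_isClosed_range hR'.1.1 hR'.1.2).and
      ((eventually_codim_range_eq_of_lt_top hR'.1.1
        (hR'.2.trans_lt (ENat.natCast_lt_top n))).mono fun _ h ↦ h.trans_le hR'.2)
  obtain ⟨ε, hε, hball⟩ := Metric.mem_nhds_iff.1 (eventually_injective_isClosed_range hi hc)
  let _ := NormedSpace.restrictScalars ℝ 𝕜 (E →L[𝕜] F)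
  have hsub (n : ℕ) : Metric.ball R ε ⊆ u n := by
    refine (convex_ball R ε).isPreconnected.subset_left_of_subset_union (hu n) (hv n) ?_ ?_ ?_
    · refine Set.disjoint_left.2 fun R' h h' ↦ ?_
      have := h.2.trans h'.2
      norm_cast at this
      omega
    · refine fun R' hR' ↦ (lt_or_ge (n : ℕ∞) (codim R'.range)).imp (fun h ↦ ⟨hball hR', ?_⟩)
        (fun h ↦ ⟨hball hR', h⟩)
      exact_mod_cast Order.add_one_le_of_lt h
    · exact ⟨R, Metric.mem_ball_self hε, ⟨hi, hc⟩, hf ▸ le_top⟩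
  filter_upwards [Metric.ball_mem_nhds R hε] with R' hR'
  rw [hf, ENat.eq_top_iff_forall_ge]
  exact fun n ↦ le_trans (by norm_cast; omega) (hsub n hR').2

section Index

lemma coe_add_sub_coe_add (a b : ℕ∞) {c : ℕ∞} (hc : c ≠ ⊤) :
    (((a + c : ℕ∞) : ℝ≥0∞) : EReal) - ((b + c : ℕ∞) : ℝ≥0∞) =
      ((a : ℝ≥0∞) : EReal) - (b : ℝ≥0∞) := by
  lift c to ℕ using hc
  have hc : ((((c : ℕ∞) : ℝ≥0∞) : EReal) - (((c : ℕ∞) : ℝ≥0∞) : EReal)) = 0 := by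
    apply EReal.sub_self <;> simp
  push_cast at hc ⊢
  rw [EReal.add_sub_add_comm]
  · rw [hc, add_zero]
  all_goals simp

variable {Y : Type*} [NormedAddCommGroup Y] [NormedSpace ℂ Y] {S : Y →L[ℂ] Y}

lemma nullity_lt_top : nullity S < ⊤ ↔ FiniteDimensional ℂ S.ker := by
  rw [nullity, Cardinal.toENat_lt_top, Module.rank_lt_aleph0_iff]

lemma nullity_eq_zero : nullity S = 0 ↔ Function.Injective S := by
  rw [nullity, Cardinal.toENat_eq_zero, rank_zero_iff, Submodule.subsingleton_iff_eq_bot]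
  exact LinearMap.ker_eq_bot

lemma defect_eq_zero : defect S = 0 ↔ Function.Surjective S :=
  codim_eq_zero.trans LinearMap.range_eq_top

lemma ind_nonpos_of_injective (h : Function.Injective S) : ind S ≤ 0 := by
  simp [ind, nullity_eq_zero.2 h, EReal.coe_ennreal_nonneg]

lemma ind_ne_bot_iff : ind S ≠ ⊥ ↔ defect S < ⊤ := by
  simp [ind, sub_eq_add_neg, lt_top_iff_ne_top]

lemma ind_eq_zero_iff (h : nullity S < ⊤) : ind S = 0 ↔ nullity S = defect S := by
  have htop : ((nullity S : ℝ≥0∞) : EReal) ≠ ⊤ := by simp [h.ne]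
  rw [ind, le_antisymm_iff, EReal.sub_nonpos, EReal.sub_nonneg (.inl htop) (.inl (by simp)),
    ← le_antisymm_iff, EReal.coe_ennreal_eq_coe_ennreal_iff, ENat.toENNReal_inj]

/-- The range of `S` on a complement of the kernel determines the index: both `codim Z` and
`codim (S Z)` exceed `α(S)` and `β(S)` by the same finite amount. -/
lemma ind_eq_codim_sub_codim {Z : Submodule ℂ Y} (hd : Disjoint S.ker Z) (hZ : codim Z < ⊤) :
    ind S = ((codim Z : ℝ≥0∞) : EReal) - (codim (Z.map S.toLinearMap) : ℝ≥0∞) := by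
  obtain ⟨r, hr, hr'⟩ := exists_rank_ker_add S.toLinearMap hd
  have hrtop : r ≠ ⊤ := ne_top_of_le_ne_top (hr ▸ hZ.ne) le_add_self
  rw [← hr, ← hr', coe_add_sub_coe_add _ _ hrtop]
  rfl

lemma range_domRestrict_of_codisjoint {Z : Submodule ℂ Y} (h : Codisjoint S.ker Z) :
    (S.domRestrict Z).range = S.range := by
  have hr : (S.domRestrict Z).range = Z.map S.toLinearMap := S.toLinearMap.range_domRestrict Z
  rw [hr, ← Submodule.map_top, ← h.eq_top, Submodule.map_sup, right_eq_sup]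
  rintro _ ⟨x, hx, rfl⟩
  rw [show S.toLinearMap x = 0 from hx]
  exact zero_mem _

lemma injective_domRestrict_iff {Z : Submodule ℂ Y} :
    Function.Injective (S.domRestrict Z) ↔ Disjoint S.ker Z := by
  rw [disjoint_comm, Submodule.disjoint_iff_comap_eq_bot, ← LinearMap.ker_domRestrict]
  exact LinearMap.ker_eq_bot.symm

theorem IsUpperSemiFredholm.eventually_ind_eq [CompleteSpace Y] (h : IsUpperSemiFredholm S) :
    ∀ᶠ S' : Y →L[ℂ] Y in 𝓝 S, IsUpperSemiFredholm S' ∧ ind S' = ind S := by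
  have := nullity_lt_top.1 h.2
  obtain ⟨Z, hZ, hc⟩ :=
    (Submodule.ClosedComplemented.of_finiteDimensional S.ker).exists_isClosed_isCompl
  have : CompleteSpace Z := hZ.completeSpace_coe
  have hZfin : codim Z < ⊤ := codim_eq_of_isCompl hc.symm ▸ h.2
  have := codim_lt_top.1 hZfin
  have hr (S' : Y →L[ℂ] Y) : (S'.domRestrict Z).range = Z.map S'.toLinearMap :=
    S'.toLinearMap.range_domRestrict Z
  have hcont : Continuous fun S' : Y →L[ℂ] Y ↦ S'.domRestrict Z :=
    (ContinuousLinearMap.compL ℂ Z Y Y).flip Z.subtypeL |>.continuous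
  have hi : Function.Injective (S.domRestrict Z) := injective_domRestrict_iff.2 hc.disjoint
  have hcl : IsClosed (Set.range (S.domRestrict Z)) := by
    have := h.1
    rwa [← range_domRestrict_of_codisjoint hc.codisjoint] at this
  filter_upwards [hcont.continuousAt.eventually (eventually_injective_isClosed_range hi hcl),
    hcont.continuousAt.eventually (eventually_codim_range_eq hi hcl)] with S' ⟨hi', hcl'⟩ hcodim
  have hd' : Disjoint S'.ker Z := injective_domRestrict_iff.1 hi'
  rw [hr, hr] at hcodim
  refine ⟨⟨?_, ?_⟩, ?_⟩
  · refine LinearMap.isClosed_range_of_isClosed_map_of_finiteDimensional_quotient (s := Z) ?_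
    rw [← hr]
    exact hcl'
  · exact (rank_le_codim hd'.symm).trans_lt hZfin
  · rw [ind_eq_codim_sub_codim hd' hZfin, ind_eq_codim_sub_codim hc.disjoint hZfin, hcodim]

lemma tendsto_sub_smul_one (S : Y →L[ℂ] Y) :
    Tendsto (fun w : ℂ ↦ S - w • (1 : Y →L[ℂ] Y)) (𝓝 0) (𝓝 S) := by
  have h : Continuous fun w : ℂ ↦ S - w • (1 : Y →L[ℂ] Y) := by fun_prop
  simpa using h.tendsto 0

end Index

section ClosedRange

variable {𝕜 E F : Type*} [NontriviallyNormedField 𝕜]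
  [NormedAddCommGroup E] [NormedSpace 𝕜 E] [CompleteSpace E]
  [NormedAddCommGroup F] [NormedSpace 𝕜 F] [CompleteSpace F] {A : E →L[𝕜] F}

lemma isQuotientMap_rangeRestrict (hA : IsClosed (A.range : Set F)) :
    IsQuotientMap A.rangeRestrict :=
  have : CompleteSpace A.range := hA.completeSpace_coe
  have hs : Function.Surjective A.rangeRestrict := A.toLinearMap.surjective_rangeRestrict
  (A.rangeRestrict.isOpenMap hs).isQuotientMap A.rangeRestrict.continuous hs

lemma isClosed_map_of_isClosed_sup_ker (hA : IsClosed (A.range : Set F)) {W : Submodule 𝕜 E}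
    (hW : IsClosed ((W ⊔ A.ker : Submodule 𝕜 E) : Set E)) :
    IsClosed (W.map A.toLinearMap : Set F) := by
  have hpre : A.rangeRestrict ⁻¹' (Subtype.val ⁻¹' (W.map A.toLinearMap : Set F)) =
      ((W ⊔ A.ker : Submodule 𝕜 E) : Set E) := by
    rw [← Submodule.comap_map_eq]
    rfl
  have hcl := (isQuotientMap_rangeRestrict hA).isClosed_preimage.1 (hpre ▸ hW)
  have hsub : (W.map A.toLinearMap : Set F) ⊆ A.range := LinearMap.map_le_range
  rw [← Set.inter_eq_right.2 hsub, ← Subtype.image_preimage_coe]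
  exact hA.isClosedMap_subtype_val _ hcl

end ClosedRange

lemma exists_comp_eq_of_ker_le {𝕜 E F G : Type*} [RCLike 𝕜]
    [NormedAddCommGroup E] [NormedSpace 𝕜 E] [CompleteSpace E]
    [NormedAddCommGroup F] [NormedSpace 𝕜 F] [CompleteSpace F]
    [NormedAddCommGroup G] [NormedSpace 𝕜 G] [FiniteDimensional 𝕜 G] {A : E →L[𝕜] F}
    (hA : IsClosed (A.range : Set F)) {f : E →L[𝕜] G} (hf : A.ker ≤ f.ker) :
    ∃ g : F →L[𝕜] G, g ∘L A = f := by
  let f₀ : A.range →ₗ[𝕜] G := A.ker.liftQ f.toLinearMap hf ∘ₗ A.toLinearMap.quotKerEquivRange.symm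
  have hf₀ : f₀ ∘ A.rangeRestrict = f := by
    ext x
    exact congrArg (A.ker.liftQ f.toLinearMap hf)
      (A.toLinearMap.quotKerEquivRange_symm_apply_image x _)
  have hcont : Continuous f₀ := by
    rw [(isQuotientMap_rangeRestrict hA).continuous_iff, hf₀]
    exact f.continuous
  obtain ⟨g, hg⟩ := ContinuousLinearMap.exist_extension_of_finiteDimensional_range
    (⟨f₀, hcont⟩ : A.range →L[𝕜] G)
  refine ⟨g, ContinuousLinearMap.ext fun x ↦ ?_⟩
  rw [← congrFun hf₀ x]
  exact (DFunLike.congr_fun hg (A.rangeRestrict x)).symm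

section Ascent

variable {Y : Type*} [NormedAddCommGroup Y] [NormedSpace ℂ Y] {S : Y →L[ℂ] Y}

lemma sInf_natCast_lt_top {p : ℕ → Prop} : sInf {k : ℕ∞ | ∃ n : ℕ, k = n ∧ p n} < ⊤ ↔ ∃ n, p n := by
  rw [sInf_lt_iff]
  constructor
  · rintro ⟨_, ⟨n, -, hn⟩, -⟩
    exact ⟨n, hn⟩
  · rintro ⟨n, hn⟩
    exact ⟨n, ⟨n, rfl, hn⟩, ENat.natCast_lt_top n⟩

lemma ascent_lt_top : ascent S < ⊤ ↔ ∃ n : ℕ, (S ^ n).ker = (S ^ (n + 1)).ker :=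
  sInf_natCast_lt_top

lemma descent_lt_top : descent S < ⊤ ↔ ∃ n : ℕ, (S ^ n).range = (S ^ (n + 1)).range :=
  sInf_natCast_lt_top

lemma ascent_lt_top_of_injective (h : Function.Injective S) : ascent S < ⊤ := by
  refine ascent_lt_top.2 ⟨0, ?_⟩
  rw [zero_add, pow_one, LinearMap.ker_eq_bot.2 h]
  exact LinearMap.ker_id

lemma isUpperSemiFredholm_of_surjective (hs : Function.Surjective S) (hS : nullity S < ⊤) :
    IsUpperSemiFredholm S := by
  refine ⟨?_, hS⟩
  rw [LinearMap.range_eq_top.2 hs]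
  exact isClosed_univ

lemma IsUpperSemiFredholm.isClosed_map [CompleteSpace Y] (h : IsUpperSemiFredholm S)
    {W : Submodule ℂ Y} (hW : IsClosed (W : Set Y)) : IsClosed (W.map S.toLinearMap : Set Y) :=
  have := nullity_lt_top.1 h.2
  isClosed_map_of_isClosed_sup_ker h.1 (Submodule.isClosed_sup_finiteDimensional W S.ker hW)

lemma finiteDimensional_ker_mul {S' : Y →L[ℂ] Y} [FiniteDimensional ℂ S.ker]
    [FiniteDimensional ℂ S'.ker] : FiniteDimensional ℂ (S * S').ker := by
  refine Module.Finite.iff_fg.2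
    (Submodule.fg_of_fg_map_of_fg_inf_ker S'.toLinearMap ?_ ?_)
  · have hle : (S * S').ker.map S'.toLinearMap ≤ S.ker := by
      rintro _ ⟨x, hx, rfl⟩
      exact hx
    exact Module.Finite.iff_fg.1 (Submodule.finiteDimensional_of_le hle)
  · exact Module.Finite.iff_fg.1 (Submodule.finiteDimensional_of_le inf_le_right)

lemma IsUpperSemiFredholm.pow [CompleteSpace Y] (h : IsUpperSemiFredholm S) (n : ℕ) :
    IsUpperSemiFredholm (S ^ n) := by
  induction n with
  | zero =>
    refine isUpperSemiFredholm_of_surjective Function.surjective_id ?_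
    rw [nullity_eq_zero.2 Function.injective_id]
    exact ENat.natCast_lt_top 0
  | succ n ih =>
    have := nullity_lt_top.1 h.2
    have := nullity_lt_top.1 ih.2
    rw [pow_succ']
    refine ⟨?_, nullity_lt_top.2 finiteDimensional_ker_mul⟩
    have hr : (S * S ^ n).range = (S ^ n).range.map S.toLinearMap := LinearMap.range_comp _ _
    rw [hr]
    exact h.isClosed_map ih.1

end Ascent

section Retraction

variable {Y G : Type*} [NormedAddCommGroup Y] [NormedSpace ℂ Y] [CompleteSpace Y]
  [NormedAddCommGroup G] [NormedSpace ℂ G] [FiniteDimensional ℂ G] {S : Y →L[ℂ] Y}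
  {K : Submodule ℂ Y} [FiniteDimensional ℂ K]

lemma exists_comp_eq_of_vanishing (hS : IsClosed (S.range : Set Y)) (hK : ∀ x, S x ∈ K → x ∈ K)
    {f : Y →L[ℂ] G} (hf : ∀ x ∈ K, f x = 0) :
    ∃ g : Y →L[ℂ] G, (∀ x ∈ K, g x = 0) ∧ ∀ x, g (S x) = f x := by
  obtain ⟨Q, hQ⟩ := Submodule.ClosedComplemented.of_finiteDimensional K
  let D : Y →L[ℂ] Y := ContinuousLinearMap.id ℂ Y - K.subtypeL ∘L Q
  have hD (x : Y) : D x = 0 ↔ x ∈ K := by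
    refine ⟨fun h ↦ ?_, fun h ↦ ?_⟩
    · rw [sub_eq_zero.1 (show x - Q x = 0 from h)]
      exact (Q x).2
    · change x - Q x = 0
      rw [hQ ⟨x, h⟩, sub_self]
  have hDker : D.ker = K := Submodule.ext hD
  have hDrange : D.range = Q.ker := by
    ext y
    constructor
    · rintro ⟨x, rfl⟩
      change Q (x - Q x) = 0
      rw [map_sub, hQ, sub_self]
    · intro hy
      refine ⟨y, ?_⟩
      change y - Q y = y
      rw [show Q y = 0 from hy, Submodule.coe_zero, sub_zero]
  have hclosed : IsClosed ((D ∘L S).range : Set Y) := by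
    have hr : (D ∘L S).range = S.range.map D.toLinearMap := LinearMap.range_comp _ _
    rw [hr]
    refine isClosed_map_of_isClosed_sup_ker ?_ ?_
    · rw [hDrange]
      exact Q.isClosed_ker
    · rw [hDker]
      exact Submodule.isClosed_sup_finiteDimensional S.range K hS
  obtain ⟨g, hg⟩ := exists_comp_eq_of_ker_le hclosed (f := f)
    fun x hx ↦ hf x (hK x ((hD _).1 hx))
  refine ⟨g ∘L D, fun x hx ↦ ?_, fun x ↦ DFunLike.congr_fun hg x⟩
  rw [ContinuousLinearMap.comp_apply, (hD x).2 hx, map_zero]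

/-- With `N` the operator induced on a finite-dimensional target, `E ↦ E S` is surjective on the
maps vanishing on `K`, so its difference with the commuting nilpotent `E ↦ N E` is surjective. -/
lemma exists_intertwining_defect_eq (hS : IsClosed (S.range : Set Y)) (hK : ∀ x, S x ∈ K → x ∈ K)
    {N : G →L[ℂ] G} (hN : IsNilpotent N) {f : Y →L[ℂ] G} (hf : ∀ x ∈ K, f x = 0) :
    ∃ E : Y →L[ℂ] G, (∀ x ∈ K, E x = 0) ∧ ∀ x, E (S x) - N (E x) = f x := by
  have hstep (m : ℕ) : ∃ E R : Y →L[ℂ] G, (∀ x ∈ K, E x = 0) ∧ (∀ x ∈ K, R x = 0) ∧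
      ∀ x, E (S x) - N (E x) = f x - (N ^ m) (R x) := by
    induction m with
    | zero => exact ⟨0, f, by simp, hf, by simp⟩
    | succ m ih =>
      obtain ⟨E, R, hE, hR, h⟩ := ih
      obtain ⟨g, hg, hgS⟩ := exists_comp_eq_of_vanishing hS hK hR
      refine ⟨E + (N ^ m) ∘L g, g, fun x hx ↦ by simp [hE x hx, hg x hx], hg, fun x ↦ ?_⟩
      simp only [add_apply, ContinuousLinearMap.comp_apply, map_add, hgS, pow_succ',
        mul_apply_eq_comp, add_sub_add_comm, h x]
      abel
  obtain ⟨n, hn⟩ := hN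
  obtain ⟨E, R, hE, -, h⟩ := hstep n
  exact ⟨E, hE, fun x ↦ by simpa [hn] using h x⟩

lemma exists_equivariant_retraction (hS : IsClosed (S.range : Set Y))
    (hK : ∀ x ∈ K, S x ∈ K) (hK' : ∀ x, S x ∈ K → x ∈ K) (hN : IsNilpotent (S.restrict hK)) :
    ∃ P : Y →L[ℂ] K, (∀ x : K, P x = x) ∧ ∀ x, P (S x) = S.restrict hK (P x) := by
  obtain ⟨Q, hQ⟩ := Submodule.ClosedComplemented.of_finiteDimensional K
  obtain ⟨E, hE, hES⟩ := exists_intertwining_defect_eq hS hK' hN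
    (f := Q ∘L S - S.restrict hK ∘L Q) fun x hx ↦ by
      have h₁ : Q (S x) = S.restrict hK ⟨x, hx⟩ := hQ (S.restrict hK ⟨x, hx⟩)
      have h₂ : Q x = ⟨x, hx⟩ := hQ ⟨x, hx⟩
      simp [h₁, h₂]
  refine ⟨Q - E, fun x ↦ by simp [hQ, hE x x.2], fun x ↦ ?_⟩
  have h : E (S x) - S.restrict hK (E x) = Q (S x) - S.restrict hK (Q x) := hES x
  rw [sub_apply, sub_apply, map_sub, sub_eq_sub_iff_sub_eq_sub, h]

end Retraction

section Similarity

variable {Y Y' Y'' Z Z' : Type u} [NormedAddCommGroup Y] [NormedSpace ℂ Y] [NormedAddCommGroup Y']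
  [NormedSpace ℂ Y'] [NormedAddCommGroup Y''] [NormedSpace ℂ Y''] [NormedAddCommGroup Z]
  [NormedSpace ℂ Z] [NormedAddCommGroup Z'] [NormedSpace ℂ Z']
  {S : Y →L[ℂ] Y} {S' : Y' →L[ℂ] Y'} {S'' : Y'' →L[ℂ] Y''} {A : Z →L[ℂ] Z} {A' : Z' →L[ℂ] Z'}

/-- Similarity of operators, possibly on different spaces: conjugacy by an isomorphism. -/
def Similar (S : Y →L[ℂ] Y) (S' : Y' →L[ℂ] Y') : Prop :=
  ∃ e : Y ≃L[ℂ] Y', ∀ x, e (S x) = S' (e x)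

lemma Similar.refl (S : Y →L[ℂ] Y) : Similar S S := ⟨.refl ℂ Y, fun _ ↦ rfl⟩

lemma Similar.symm (h : Similar S S') : Similar S' S := by
  obtain ⟨e, he⟩ := h
  exact ⟨e.symm, fun x ↦ by rw [e.symm_apply_eq, he, e.apply_symm_apply]⟩

lemma Similar.trans (h : Similar S S') (h' : Similar S' S'') : Similar S S'' := by
  obtain ⟨e, he⟩ := h
  obtain ⟨e', he'⟩ := h'
  exact ⟨e.trans e', fun x ↦ by simp [he, he']⟩

lemma Similar.prodMap (h : Similar S S') (h' : Similar A A') :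
    Similar (S.prodMap A) (S'.prodMap A') := by
  obtain ⟨e, he⟩ := h
  obtain ⟨e', he'⟩ := h'
  exact ⟨e.prodCongr e', fun x ↦ Prod.ext (he x.1) (he' x.2)⟩

lemma Similar.prodMap_assoc (S : Y →L[ℂ] Y) (S' : Y' →L[ℂ] Y') (A : Z →L[ℂ] Z) :
    Similar ((S.prodMap S').prodMap A) (S.prodMap (S'.prodMap A)) :=
  ⟨.prodAssoc ℂ Y Y' Z, fun _ ↦ rfl⟩

lemma Similar.exists_map_ker_range (h : Similar S S') :
    ∃ e : Y ≃L[ℂ] Y', S'.ker = S.ker.map e.toLinearMap ∧ S'.range = S.range.map e.toLinearMap := by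
  obtain ⟨e, he⟩ := h
  refine ⟨e, ?_, ?_⟩
  · ext y
    rw [Submodule.mem_map_equiv (e := e.toLinearEquiv)]
    change S' y = 0 ↔ S (e.symm y) = 0
    rw [← e.map_eq_zero_iff, he, e.apply_symm_apply]
  · ext y
    constructor
    · rintro ⟨y, rfl⟩
      exact ⟨S (e.symm y), ⟨_, rfl⟩, by simp [he]⟩
    · rintro ⟨_, ⟨x, rfl⟩, rfl⟩
      exact ⟨e x, (he x).symm⟩

lemma Similar.nullity_eq (h : Similar S S') : nullity S' = nullity S := by
  obtain ⟨e, hk, -⟩ := h.exists_map_ker_range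
  rw [nullity, nullity, hk]
  exact congrArg _ (e.toLinearEquiv.rank_map_eq S.ker)

lemma Similar.defect_eq (h : Similar S S') : defect S' = defect S := by
  obtain ⟨e, -, hr⟩ := h.exists_map_ker_range
  rw [defect, hr]
  exact codim_map_equiv e.toLinearEquiv S.range

lemma Similar.ind_eq (h : Similar S S') : ind S' = ind S := by
  rw [ind, ind, h.nullity_eq, h.defect_eq]

lemma Similar.isUpperSemiFredholm (h : Similar S S') (hS : IsUpperSemiFredholm S) :
    IsUpperSemiFredholm S' := by
  refine ⟨?_, h.nullity_eq ▸ hS.2⟩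
  obtain ⟨e, -, hr⟩ := h.exists_map_ker_range
  rw [hr]
  exact e.toHomeomorph.isClosedMap _ hS.1

lemma Similar.spectrum_eq (h : Similar S S') : spectrum ℂ S' = spectrum ℂ S := by
  obtain ⟨e, he⟩ := h
  have hconj : e.conjContinuousAlgEquiv S = S' := by
    ext x
    rw [e.conjContinuousAlgEquiv_apply_apply, he, e.apply_symm_apply]
  rw [← hconj, AlgEquiv.spectrum_eq]

lemma Similar.isZeroloid (h : Similar S S') (hS : IsZeroloid S) : IsZeroloid S' := by
  rw [IsZeroloid, h.spectrum_eq]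
  exact hS

lemma nullity_prodMap : nullity (S.prodMap S') = nullity S + nullity S' := by
  rw [nullity, ContinuousLinearMap.coe_prodMap, LinearMap.ker_prodMap, rank_submodule_prod, map_add]
  rfl

lemma range_prodMap : (S.prodMap S').range = S.range.prod S'.range :=
  LinearMap.range_prodMap ..

lemma defect_prodMap : defect (S.prodMap S') = defect S + defect S' := by
  rw [defect, range_prodMap]
  exact codim_prod ..

lemma isClosed_range_prodMap : IsClosed ((S.prodMap S').range : Set (Y × Y')) ↔
    IsClosed (S.range : Set Y) ∧ IsClosed (S'.range : Set Y') := by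
  have hr : ((S.prodMap S').range : Set (Y × Y')) = (S.range : Set Y) ×ˢ (S'.range : Set Y') := by
    rw [range_prodMap]
    rfl
  rw [hr]
  refine ⟨fun h ↦ ⟨?_, ?_⟩, fun h ↦ h.1.prod h.2⟩
  · simpa using h.preimage (Continuous.prodMk_left (0 : Y'))
  · simpa using h.preimage (Continuous.prodMk_right (0 : Y))

lemma isUpperSemiFredholm_prodMap : IsUpperSemiFredholm (S.prodMap S') ↔
    IsUpperSemiFredholm S ∧ IsUpperSemiFredholm S' := by
  rw [IsUpperSemiFredholm, isClosed_range_prodMap, nullity_prodMap, ENat.add_lt_top,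
    and_and_and_comm]
  rfl

lemma spectrum_prodMap_subset : spectrum ℂ (S.prodMap S') ⊆ spectrum ℂ S ∪ spectrum ℂ S' := by
  let φ : (Y →L[ℂ] Y) × (Y' →L[ℂ] Y') →ₐ[ℂ] (Y × Y' →L[ℂ] Y × Y') :=
    .ofLinearMap (ContinuousLinearMap.prodMapL ℂ Y Y Y' Y').toLinearMap rfl fun _ _ ↦ rfl
  rw [← Prod.spectrum_eq]
  exact AlgHom.spectrum_apply_subset φ (S, S')

lemma IsZeroloid.prodMap (hS : IsZeroloid S) (hS' : IsZeroloid S') : IsZeroloid (S.prodMap S') :=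
  (derivedSet_mono _ _ spectrum_prodMap_subset).trans <| by
    rw [derivedSet_union]
    exact Set.union_subset hS hS'

end Similarity

section Decomposition

variable {X Z Z' : Type u} [NormedAddCommGroup X] [NormedSpace ℂ X]
  [NormedAddCommGroup Z] [NormedSpace ℂ Z] [NormedAddCommGroup Z'] [NormedSpace ℂ Z']
  {S : X →L[ℂ] X} {A : Z →L[ℂ] Z} {B : Z' →L[ℂ] Z'}

lemma IsRed.similar_prodMap [CompleteSpace X] {M N : Submodule ℂ X} (h : IsRed S M N) :
    Similar ((S.restrict h.invariant_left).prodMap (S.restrict h.invariant_right)) S := by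
  refine ⟨Submodule.prodEquivOfIsTopCompl M N
    (Submodule.IsCompl.isTopCompl_of_isClosed h.isCompl h.isClosed_left h.isClosed_right),
    fun x ↦ ?_⟩
  simp

lemma similar_restrict {M : Submodule ℂ X} (hM : ∀ x ∈ M, S x ∈ M) {i : Z →L[ℂ] X} {p : X →L[ℂ] Z}
    (hi : ∀ z, i z ∈ M) (hpi : ∀ z, p (i z) = z) (hip : ∀ x ∈ M, i (p x) = x)
    (hS : ∀ z, i (A z) = S (i z)) : Similar A (S.restrict hM) :=
  ⟨.equivOfInverse (i.codRestrict M hi) (p ∘L M.subtypeL) hpi fun x ↦ Subtype.ext (hip x x.2),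
    fun z ↦ Subtype.ext (hS z)⟩

theorem Similar.exists_isRed (h : Similar (A.prodMap B) S) :
    ∃ (M N : Submodule ℂ X) (h : IsRed S M N),
      Similar A (S.restrict h.invariant_left) ∧ Similar B (S.restrict h.invariant_right) := by
  obtain ⟨e, he⟩ := h
  let p : X →L[ℂ] Z := .fst ℂ Z Z' ∘L e.symm
  let q : X →L[ℂ] Z' := .snd ℂ Z Z' ∘L e.symm
  let i : Z →L[ℂ] X := e ∘L .inl ℂ Z Z'
  let j : Z' →L[ℂ] X := e ∘L .inr ℂ Z Z'
  have hsymm (x : X) : e.symm (S x) = (A (p x), B (q x)) := by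
    rw [e.symm_apply_eq, ← e.apply_symm_apply x, ← he]
    simp [p, q, Prod.map]
  have hip (x : X) (hx : x ∈ q.ker) : i (p x) = x :=
    e.eq_symm_apply.1 (Prod.ext rfl (show q x = 0 from hx).symm)
  have hjq (x : X) (hx : x ∈ p.ker) : j (q x) = x :=
    e.eq_symm_apply.1 (Prod.ext (show p x = 0 from hx).symm rfl)
  have hpi (z : Z) : p (i z) = z := by simp [p, i]
  have hqi (z : Z) : q (i z) = 0 := by simp [q, i]
  have hpj (z : Z') : p (j z) = 0 := by simp [p, j]
  have hqj (z : Z') : q (j z) = z := by simp [q, j]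
  have hred : IsRed S q.ker p.ker :=
    { isClosed_left := q.isClosed_ker
      isClosed_right := p.isClosed_ker
      invariant_left := fun x hx ↦ by
        change (e.symm (S x)).2 = 0
        rw [hsymm, show q x = 0 from hx, map_zero]
      invariant_right := fun x hx ↦ by
        change (e.symm (S x)).1 = 0
        rw [hsymm, show p x = 0 from hx, map_zero]
      isCompl := by
        refine ⟨Submodule.disjoint_def.2 fun x hq hp ↦ ?_, ?_⟩
        · rw [← hip x hq, show p x = 0 from hp, map_zero]
        · refine Submodule.codisjoint_iff_exists_add_eq.2 fun x ↦
            ⟨i (p x), j (q x), hqi _, hpj _, ?_⟩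
          simp [i, j, p, q, ← map_add] }
  exact ⟨_, _, hred, similar_restrict hred.invariant_left hqi hpi hip fun z ↦ by simp [i, ← he],
    similar_restrict hred.invariant_right hpj hqj hjq fun z ↦ by simp [j, ← he]⟩

end Decomposition

section Splitting

variable {Y : Type*} [NormedAddCommGroup Y] [NormedSpace ℂ Y] {S : Y →L[ℂ] Y}

lemma coe_restrict_pow {M : Submodule ℂ Y} (h : ∀ x ∈ M, S x ∈ M) (n : ℕ) (x : M) :
    ((S.restrict h ^ n) x : Y) = (S ^ n) x := by
  induction n with
  | zero => rfl
  | succ n ih =>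
    rw [pow_succ', pow_succ', mul_apply_eq_comp, mul_apply_eq_comp, ← ih]
    rfl

lemma pow_succ_apply' (S : Y →L[ℂ] Y) (n : ℕ) (x : Y) : (S ^ (n + 1)) x = S ((S ^ n) x) := by
  rw [pow_succ', mul_apply_eq_comp]

theorem IsUpperSemiFredholm.exists_isRed_of_ascent_lt_top [CompleteSpace Y]
    (h : IsUpperSemiFredholm S) (ha : ascent S < ⊤) :
    ∃ (M N : Submodule ℂ Y) (h : IsRed S M N),
      Function.Injective (S.restrict h.invariant_left) ∧ FiniteDimensional ℂ N := by
  obtain ⟨n, hn⟩ := ascent_lt_top.1 ha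
  let K : Submodule ℂ Y := (S ^ n).ker
  have : FiniteDimensional ℂ K := nullity_lt_top.1 (h.pow n).2
  have hmem (x : Y) : S x ∈ K ↔ x ∈ K := by
    conv_rhs => rw [show K = (S ^ (n + 1)).ker from hn, pow_succ]
    rfl
  have hK (x : Y) (hx : x ∈ K) : S x ∈ K := (hmem x).2 hx
  have hnil : IsNilpotent (S.restrict hK) :=
    ⟨n, ContinuousLinearMap.ext fun x ↦ Subtype.ext ((coe_restrict_pow hK n x).trans x.2)⟩
  obtain ⟨P, hP, hPS⟩ := exists_equivariant_retraction h.1 hK (fun x ↦ (hmem x).1) hnil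
  have hinv (x : Y) (hx : x ∈ P.ker) : S x ∈ P.ker := by
    change P (S x) = 0
    rw [hPS, show P x = 0 from hx, map_zero]
  refine ⟨P.ker, K, ⟨P.isClosed_ker, K.closed_of_finiteDimensional, hinv, hK,
    (LinearMap.isCompl_of_proj hP).symm⟩, ?_, this⟩
  refine (injective_iff_map_eq_zero _).2 fun x hx ↦ Subtype.ext ?_
  have hSx : S x = 0 := congrArg Subtype.val hx
  have hxK : (x : Y) ∈ K := (hmem x).1 (by rw [hSx]; exact zero_mem K)
  exact (congrArg Subtype.val (hP ⟨x, hxK⟩)).symm.trans (congrArg Subtype.val x.2)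

end Splitting

section IndexClasses

/-- `S` is upper semi-Fredholm with index in `J`. The classes of the paper are the cases
`J = {0}` (Weyl), `J = {⊥}ᶜ` (Fredholm) and `J = Set.Iic 0` (upper semi-Weyl). -/
def HasIndexIn {Y : Type*} [NormedAddCommGroup Y] [NormedSpace ℂ Y] (J : Set EReal)
    (S : Y →L[ℂ] Y) : Prop :=
  IsUpperSemiFredholm S ∧ ind S ∈ J

variable {Y Z : Type u} [NormedAddCommGroup Y] [NormedSpace ℂ Y] [NormedAddCommGroup Z]
  [NormedSpace ℂ Z] {S : Y →L[ℂ] Y} {B : Z →L[ℂ] Z} {J : Set EReal}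

lemma Similar.hasIndexIn (h : Similar S B) (hS : HasIndexIn J S) : HasIndexIn J B :=
  ⟨h.isUpperSemiFredholm hS.1, h.ind_eq ▸ hS.2⟩

lemma HasIndexIn.eventually [CompleteSpace Y] (h : HasIndexIn J S) :
    ∀ᶠ S' : Y →L[ℂ] Y in 𝓝 S, HasIndexIn J S' :=
  h.1.eventually_ind_eq.mono fun _ h' ↦ ⟨h'.1, h'.2 ▸ h.2⟩

lemma hasIndexIn_zero_iff : HasIndexIn {0} S ↔ IsUpperSemiFredholm S ∧ nullity S = defect S :=
  and_congr_right fun h ↦ ind_eq_zero_iff h.2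

lemma hasIndexIn_zero_of_bijective (h : Function.Bijective S) : HasIndexIn {0} S := by
  have h₀ := nullity_eq_zero.2 h.1
  refine hasIndexIn_zero_iff.2 ⟨isUpperSemiFredholm_of_surjective h.2 ?_, ?_⟩
  · rw [h₀]
    exact ENat.natCast_lt_top 0
  · rw [h₀, defect_eq_zero.2 h.2]

lemma hasIndexIn_zero_of_finiteDimensional [FiniteDimensional ℂ Y] : HasIndexIn {0} S := by
  refine hasIndexIn_zero_iff.2
    ⟨⟨S.range.closed_of_finiteDimensional, nullity_lt_top.2 inferInstance⟩, ?_⟩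
  have h₁ := LinearMap.finrank_range_add_finrank_ker S.toLinearMap
  have h₂ := S.range.finrank_quotient_add_finrank
  have : Module.finrank ℂ S.ker = Module.finrank ℂ (Y ⧸ S.range) := by omega
  rw [nullity, defect, ← Module.finrank_eq_rank, ← Module.finrank_eq_rank, this]

lemma hasIndexIn_prodMap_iff (hB : HasIndexIn {0} B) :
    HasIndexIn J (S.prodMap B) ↔ HasIndexIn J S := by
  rw [HasIndexIn, HasIndexIn, isUpperSemiFredholm_prodMap, and_iff_left hB.1, ind, nullity_prodMap,
    defect_prodMap, ← (hasIndexIn_zero_iff.1 hB).2, coe_add_sub_coe_add _ _ hB.1.2.ne, ind]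

end IndexClasses

section Hyperrange

variable {Y : Type*} [NormedAddCommGroup Y] [NormedSpace ℂ Y] {S : Y →L[ℂ] Y}

lemma IsUpperSemiFredholm.ind_nonpos_of_ascent_lt_top [CompleteSpace Y] (h : IsUpperSemiFredholm S)
    (ha : ascent S < ⊤) : ind S ≤ 0 := by
  obtain ⟨M, N, hred, hi, _⟩ := h.exists_isRed_of_ascent_lt_top ha
  have hS : HasIndexIn {ind S} S := ⟨h, rfl⟩
  have hM := (hasIndexIn_prodMap_iff hasIndexIn_zero_of_finiteDimensional).1
    (hred.similar_prodMap.symm.hasIndexIn hS)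
  rw [← show ind _ = ind S from hM.2]
  exact ind_nonpos_of_injective hi

/-- The hyperrange of `S`, the intersection of the ranges of its powers. -/
def hyperrange (S : Y →L[ℂ] Y) : Submodule ℂ Y := ⨅ n : ℕ, (S ^ n).range

lemma mem_hyperrange {x : Y} : x ∈ hyperrange S ↔ ∀ n : ℕ, x ∈ (S ^ n).range :=
  Submodule.mem_iInf _

lemma range_pow_antitone (S : Y →L[ℂ] Y) : Antitone fun n : ℕ ↦ (S ^ n).range := by
  refine antitone_nat_of_succ_le fun n ↦ ?_
  rw [pow_succ]
  exact LinearMap.range_comp_le_range (S : Y →ₗ[ℂ] Y) _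

lemma map_mem_hyperrange {x : Y} (hx : x ∈ hyperrange S) : S x ∈ hyperrange S := by
  refine mem_hyperrange.2 fun n ↦ ?_
  obtain ⟨y, rfl⟩ := mem_hyperrange.1 hx n
  refine range_pow_antitone S n.le_succ ⟨y, ?_⟩
  exact pow_succ_apply' S n y

lemma IsUpperSemiFredholm.isClosed_hyperrange [CompleteSpace Y] (h : IsUpperSemiFredholm S) :
    IsClosed (hyperrange S : Set Y) := by
  rw [hyperrange, Submodule.coe_iInf]
  exact isClosed_iInter fun n ↦ (h.pow n).1

lemma exists_ker_inf_range_pow_le_hyperrange [FiniteDimensional ℂ S.ker] :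
    ∃ n : ℕ, S.ker ⊓ (S ^ n).range ≤ hyperrange S := by
  let f : ℕ →o (Submodule ℂ S.ker)ᵒᵈ :=
    ⟨fun n ↦ .toDual ((S ^ n).range.comap S.ker.subtype),
      fun _ _ h ↦ Submodule.comap_mono (range_pow_antitone S h)⟩
  obtain ⟨n, hn⟩ := IsArtinian.monotone_stabilizes f
  refine ⟨n, fun x ⟨hx, hxn⟩ ↦ mem_hyperrange.2 fun m ↦ ?_⟩
  have hmax : (S ^ n).range.comap S.ker.subtype = (S ^ max n m).range.comap S.ker.subtype :=
    hn _ (le_max_left n m)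
  exact range_pow_antitone S (le_max_right n m) (hmax.le (x := ⟨x, hx⟩) hxn)

lemma surjective_restrict_hyperrange [FiniteDimensional ℂ S.ker] :
    Function.Surjective (S.restrict fun _ ↦ map_mem_hyperrange) := by
  rintro ⟨x, hx⟩
  obtain ⟨n, hn⟩ := exists_ker_inf_range_pow_le_hyperrange (S := S)
  have hpre (m : ℕ) : ∃ z ∈ (S ^ m).range, S z = x := by
    obtain ⟨y, hy⟩ := mem_hyperrange.1 hx (m + 1)
    exact ⟨(S ^ m) y, ⟨y, rfl⟩, (pow_succ_apply' S m y).symm.trans hy⟩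
  obtain ⟨z, hz, hzx⟩ := hpre n
  refine ⟨⟨z, mem_hyperrange.2 fun m ↦ ?_⟩, Subtype.ext hzx⟩
  obtain ⟨z', hz', hzx'⟩ := hpre (max n m)
  have hdiff : z - z' ∈ hyperrange S :=
    hn ⟨by change S (z - z') = 0; rw [map_sub, hzx, hzx', sub_self],
      sub_mem hz (range_pow_antitone S (le_max_left n m) hz')⟩
  rw [← sub_add_cancel z z']
  exact add_mem (mem_hyperrange.1 hdiff m) (range_pow_antitone S (le_max_right n m) hz')

lemma nullity_restrict_lt_top (h : nullity S < ⊤) {M : Submodule ℂ Y} (hM : ∀ x ∈ M, S x ∈ M) :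
    nullity (S.restrict hM) < ⊤ := by
  have := nullity_lt_top.1 h
  refine nullity_lt_top.2 (FiniteDimensional.of_injective
    (M.subtype.restrict (p := (S.restrict hM).ker) (q := S.ker) fun _ hx ↦ ?_) ?_)
  · exact congrArg Subtype.val hx
  · exact fun x y hxy ↦ Subtype.ext (Subtype.ext (congrArg (fun z : S.ker ↦ (z : Y)) hxy))

lemma ascent_restrict_lt_top (h : ascent S < ⊤) {M : Submodule ℂ Y} (hM : ∀ x ∈ M, S x ∈ M) :
    ascent (S.restrict hM) < ⊤ := by
  have hker (n : ℕ) : (S.restrict hM ^ n).ker = (S ^ n).ker.comap M.subtype := by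
    ext x
    rw [LinearMap.mem_ker, Submodule.mem_comap, LinearMap.mem_ker, ← M.coe_eq_zero]
    exact Eq.congr_left (coe_restrict_pow hM n x)
  obtain ⟨n, hn⟩ := ascent_lt_top.1 h
  exact ascent_lt_top.2 ⟨n, by rw [hker, hker, hn]⟩

lemma ascent_lt_top_of_injective_restrict_hyperrange [FiniteDimensional ℂ S.ker]
    (h : Function.Injective (S.restrict fun _ ↦ map_mem_hyperrange)) : ascent S < ⊤ := by
  obtain ⟨n, hn⟩ := exists_ker_inf_range_pow_le_hyperrange (S := S)
  refine ascent_lt_top.2 ⟨n, le_antisymm (fun x hx ↦ ?_) fun x hx ↦ ?_⟩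
  · exact (pow_succ_apply' S n x).trans (by rw [show (S ^ n) x = 0 from hx, map_zero])
  · have hSx : S ((S ^ n) x) = 0 := (pow_succ_apply' S n x).symm.trans hx
    have hmem : (S ^ n) x ∈ hyperrange S := hn ⟨hSx, x, rfl⟩
    have h₀ : (⟨_, hmem⟩ : hyperrange S) = 0 :=
      (injective_iff_map_eq_zero _).1 h _ (Subtype.ext hSx)
    exact congrArg Subtype.val h₀

theorem IsUpperSemiFredholm.ascent_lt_top_of_frequently [CompleteSpace Y]
    (h : IsUpperSemiFredholm S)
    (hw : ∃ᶠ w in 𝓝 (0 : ℂ), ascent (S - w • (1 : Y →L[ℂ] Y)) < ⊤) : ascent S < ⊤ := by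
  have := nullity_lt_top.1 h.2
  have : CompleteSpace (hyperrange S) := h.isClosed_hyperrange.completeSpace_coe
  let S₀ : hyperrange S →L[ℂ] hyperrange S := S.restrict fun _ ↦ map_mem_hyperrange
  have hsurj : Function.Surjective S₀ := surjective_restrict_hyperrange
  have hnull : nullity S₀ < ⊤ := nullity_restrict_lt_top h.2 _
  have hS₀ := isUpperSemiFredholm_of_surjective hsurj hnull
  obtain ⟨w, hasc, hw', hind⟩ :=
    (hw.and_eventually ((tendsto_sub_smul_one S₀).eventually hS₀.eventually_ind_eq)).exists
  have hinv (x : Y) (hx : x ∈ hyperrange S) :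
      (S - w • (1 : Y →L[ℂ] Y)) x ∈ hyperrange S :=
    sub_mem (map_mem_hyperrange hx) (Submodule.smul_mem _ w hx)
  have hle : ind S₀ ≤ 0 := hind ▸ hw'.ind_nonpos_of_ascent_lt_top (ascent_restrict_lt_top hasc hinv)
  refine ascent_lt_top_of_injective_restrict_hyperrange (nullity_eq_zero.1 ?_)
  rw [ind, defect_eq_zero.2 hsurj, EReal.sub_nonpos, EReal.coe_ennreal_le_coe_ennreal_iff,
    ENat.toENNReal_le] at hle
  exact nonpos_iff_eq_zero.1 hle

end Hyperrange

section Zeroloid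

lemma frequently_notMem_of_derivedSet_subset {Z : Type*} [TopologicalSpace Z] [PerfectSpace Z]
    {A : Set Z} {x : Z} (hA : derivedSet A ⊆ {x}) : ∃ᶠ w in 𝓝 x, w ∉ A := by
  by_contra h
  have hAx : ∀ᶠ w in 𝓝 x, w = x := (eventually_eventually_nhds.2 (not_frequently.1 h)).mono
    fun w hw ↦ hA <| accPt_iff_frequently_nhdsNE.2 <|
      ((hw.filter_mono nhdsWithin_le_nhds).mono fun _ ↦ not_not.1).frequently
  obtain ⟨w, hw, hne⟩ := ((hAx.filter_mono nhdsWithin_le_nhds).and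
    (self_mem_nhdsWithin (a := x) (s := {x}ᶜ))).exists
  exact hne hw

variable {Y : Type*} [NormedAddCommGroup Y] [NormedSpace ℂ Y] {S : Y →L[ℂ] Y}

lemma isZeroloid_of_finiteDimensional [FiniteDimensional ℂ Y] : IsZeroloid S := by
  have hS : (spectrum ℂ S).Finite := by
    rw [← AlgEquiv.spectrum_eq (Module.End.toContinuousLinearMap Y).symm]
    exact Module.End.finite_spectrum _
  exact fun z hz ↦ absurd hS (Set.Infinite.of_accPt hz)

lemma bijective_sub_smul_one_of_notMem_spectrum [CompleteSpace Y] {w : ℂ} (hw : w ∉ spectrum ℂ S) :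
    Function.Bijective (S - w • (1 : Y →L[ℂ] Y)) := by
  rw [spectrum.notMem_iff, IsUnit.sub_iff, Algebra.algebraMap_eq_smul_one] at hw
  exact ContinuousLinearMap.isUnit_iff_bijective.1 hw

end Zeroloid

section Restriction

variable {X : Type*} [NormedAddCommGroup X] [NormedSpace ℂ X] {S : X →L[ℂ] X} {J : Set EReal}
  {M N : Submodule ℂ X}

lemma IsRed.sub_smul_one (h : IsRed S M N) (w : ℂ) : IsRed (S - w • (1 : X →L[ℂ] X)) M N where
  isClosed_left := h.isClosed_left
  isClosed_right := h.isClosed_right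
  invariant_left x hx := sub_mem (h.invariant_left x hx) (M.smul_mem w hx)
  invariant_right x hx := sub_mem (h.invariant_right x hx) (N.smul_mem w hx)
  isCompl := h.isCompl

lemma isRed_top_bot (S : X →L[ℂ] X) : IsRed S ⊤ ⊥ where
  isClosed_left := isClosed_univ
  isClosed_right := isClosed_singleton
  invariant_left _ _ := trivial
  invariant_right x hx := by
    rw [Submodule.mem_bot] at hx ⊢
    rw [hx, map_zero]
  isCompl := isCompl_top_bot

lemma IsRed.surjective_restrict_of_descent_lt_top (h : IsRed S M N)
    (hi : Function.Injective (S.restrict h.invariant_left)) (hd : descent S < ⊤) :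
    Function.Surjective (S.restrict h.invariant_left) := by
  obtain ⟨n, hn⟩ := descent_lt_top.1 hd
  intro m
  obtain ⟨y, hy⟩ : (S ^ n) m ∈ (S ^ (n + 1)).range := hn ▸ ⟨m, rfl⟩
  obtain ⟨a, b, ha, hb, rfl⟩ := Submodule.codisjoint_iff_exists_add_eq.1 h.isCompl.codisjoint y
  lift a to M using ha
  lift b to N using hb
  refine ⟨a, ?_⟩
  have hsplit : (((S.restrict h.invariant_left) ^ n) (m - S.restrict h.invariant_left a) : X) =
      ((S.restrict h.invariant_right) ^ (n + 1)) b := by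
    rw [coe_restrict_pow, coe_restrict_pow, AddSubgroupClass.coe_sub, map_sub]
    rw [show (S ^ n) m = (S ^ (n + 1)) (a + b) from hy.symm, map_add, pow_succ S]
    exact add_sub_cancel_left _ _
  have h₀ : ((S.restrict h.invariant_left) ^ n) (m - S.restrict h.invariant_left a) = 0 :=
    Subtype.ext (Submodule.disjoint_def.1 h.isCompl.disjoint _ (Subtype.prop _)
      (hsplit ▸ Subtype.prop _))
  have hin : Function.Injective ((S.restrict h.invariant_left) ^ n) := by
    rw [FunLike.coe_pow_eq_iterate]
    exact hi.iterate n
  exact (sub_eq_zero.1 (hin (h₀.trans (map_zero _).symm))).symm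

lemma IsRed.descent_lt_top_of_surjective_restrict [FiniteDimensional ℂ N] (h : IsRed S M N)
    (hs : Function.Surjective (S.restrict h.invariant_left)) : descent S < ⊤ := by
  let f : ℕ →o (Submodule ℂ N)ᵒᵈ :=
    ⟨fun n ↦ .toDual (S.restrict h.invariant_right ^ n).range, range_pow_antitone _⟩
  obtain ⟨n, hn⟩ := IsArtinian.monotone_stabilizes f
  have hn : (S.restrict h.invariant_right ^ n).range =
      (S.restrict h.invariant_right ^ (n + 1)).range := hn (n + 1) n.le_succ
  refine descent_lt_top.2 ⟨n, (range_pow_antitone S n.le_succ).antisymm' ?_⟩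
  rintro _ ⟨x, rfl⟩
  obtain ⟨a, b, ha, hb, rfl⟩ := Submodule.codisjoint_iff_exists_add_eq.1 h.isCompl.codisjoint x
  lift a to M using ha
  lift b to N using hb
  obtain ⟨a', rfl⟩ := hs a
  obtain ⟨b', hb'⟩ : (S.restrict h.invariant_right ^ n) b ∈
    (S.restrict h.invariant_right ^ (n + 1)).range := hn ▸ ⟨b, rfl⟩
  refine ⟨a' + b', ?_⟩
  have hb' : (S ^ (n + 1)) b' = (S ^ n) b := by
    rw [← coe_restrict_pow h.invariant_right, ← coe_restrict_pow h.invariant_right]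
    exact congrArg Subtype.val hb'
  change (S ^ (n + 1)) (a' + b') = (S ^ n) (S a' + b)
  rw [map_add, map_add, hb', pow_succ, mul_apply_eq_comp]

variable [CompleteSpace X]

lemma IsRed.injective (h : IsRed S M N) (hM : Function.Injective (S.restrict h.invariant_left))
    (hN : Function.Injective (S.restrict h.invariant_right)) : Function.Injective S := by
  rw [← nullity_eq_zero, h.similar_prodMap.nullity_eq, nullity_prodMap, nullity_eq_zero.2 hM,
    nullity_eq_zero.2 hN, add_zero]

lemma IsRed.surjective (h : IsRed S M N) (hM : Function.Surjective (S.restrict h.invariant_left))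
    (hN : Function.Surjective (S.restrict h.invariant_right)) : Function.Surjective S := by
  rw [← defect_eq_zero, h.similar_prodMap.defect_eq, defect_prodMap, defect_eq_zero.2 hM,
    defect_eq_zero.2 hN, add_zero]

lemma IsRed.hasIndexIn_iff (h : IsRed S M N) (hN : HasIndexIn {0} (S.restrict h.invariant_right)) :
    HasIndexIn J S ↔ HasIndexIn J (S.restrict h.invariant_left) := by
  refine .trans ?_ (hasIndexIn_prodMap_iff hN)
  exact ⟨h.similar_prodMap.symm.hasIndexIn, h.similar_prodMap.hasIndexIn⟩

lemma IsRed.frequently_bijective_restrict_sub (h : IsRed S M N)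
    (hN : IsZeroloid (S.restrict h.invariant_right)) :
    ∃ᶠ w in 𝓝 (0 : ℂ),
      Function.Bijective
        ((S - w • (1 : X →L[ℂ] X)).restrict (h.sub_smul_one w).invariant_right) := by
  have := h.isClosed_right.completeSpace_coe
  exact (frequently_notMem_of_derivedSet_subset hN).mono fun w hw ↦
    bijective_sub_smul_one_of_notMem_spectrum hw

end Restriction

section GeneralizedClasses

variable {X : Type*} [NormedAddCommGroup X] [NormedSpace ℂ X] {S T : X →L[ℂ] X} {J J' : Set EReal}
  {M N : Submodule ℂ X}

/-- The Browder counterpart of `HasIndexIn J`: upper semi-Fredholm of finite ascent with index in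
`J`. -/
def IsBrowderIn (J : Set EReal) (S : X →L[ℂ] X) : Prop := HasIndexIn J S ∧ ascent S < ⊤

/-- The `g_z`-version of `HasIndexIn J`: a zeroloid operator may be split off. -/
def HasGzIndexIn (J : Set EReal) (S : X →L[ℂ] X) : Prop :=
  ∃ (M N : Submodule ℂ X) (h : IsRed S M N),
    HasIndexIn J (S.restrict h.invariant_left) ∧ IsZeroloid (S.restrict h.invariant_right)

/-- One-sided `g_z`-invertibility with prescribed index: `S` splits as a bounded below operator with
index in `J` plus a zeroloid one. -/
def IsGzInvertibleIn (J : Set EReal) (S : X →L[ℂ] X) : Prop :=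
  ∃ (M N : Submodule ℂ X) (h : IsRed S M N),
    HasIndexIn J (S.restrict h.invariant_left) ∧
      Function.Injective (S.restrict h.invariant_left) ∧ IsZeroloid (S.restrict h.invariant_right)

lemma HasIndexIn.mono (hJ : J' ⊆ J) (h : HasIndexIn J' S) : HasIndexIn J S := ⟨h.1, hJ h.2⟩

lemma IsGzInvertibleIn.hasGzIndexIn (hJ : J' ⊆ J) (h : IsGzInvertibleIn J' S) :
    HasGzIndexIn J S := by
  obtain ⟨M, N, h, hM, -, hN⟩ := h
  exact ⟨M, N, h, hM.mono hJ, hN⟩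

lemma spectrumOf_eq_iff {P Q : (X →L[ℂ] X) → Prop} : spectrumOf P T = spectrumOf Q T ↔
    ∀ z : ℂ, P (T - z • (1 : X →L[ℂ] X)) ↔ Q (T - z • (1 : X →L[ℂ] X)) :=
  Set.ext_iff.trans (forall_congr' fun _ ↦ not_iff_not)

variable [CompleteSpace X]

lemma IsRed.frequently_hasIndexIn (h : IsRed S M N)
    (hM : HasIndexIn J (S.restrict h.invariant_left))
    (hN : IsZeroloid (S.restrict h.invariant_right)) :
    ∃ᶠ w in 𝓝 (0 : ℂ),
      Function.Bijective ((S - w • (1 : X →L[ℂ] X)).restrict (h.sub_smul_one w).invariant_right) ∧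
        HasIndexIn J (S - w • (1 : X →L[ℂ] X)) := by
  have := h.isClosed_left.completeSpace_coe
  refine ((h.frequently_bijective_restrict_sub hN).and_eventually
    ((tendsto_sub_smul_one _).eventually hM.eventually)).mono fun w hw ↦ ⟨hw.1, ?_⟩
  exact ((h.sub_smul_one w).hasIndexIn_iff (hasIndexIn_zero_of_bijective hw.1)).2 hw.2

lemma HasIndexIn.hasGzIndexIn (h : HasIndexIn J S) : HasGzIndexIn J S :=
  ⟨⊤, ⊥, isRed_top_bot S,
    ((isRed_top_bot S).hasIndexIn_iff hasIndexIn_zero_of_finiteDimensional).1 h,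
    isZeroloid_of_finiteDimensional⟩

theorem IsGzInvertibleIn.isBrowderIn (h : IsGzInvertibleIn J S) (hS : IsUpperSemiFredholm S) :
    IsBrowderIn J S := by
  obtain ⟨M, N, h, hM, hi, hN⟩ := h
  have := h.isClosed_left.completeSpace_coe
  have hinj := (tendsto_sub_smul_one (S.restrict h.invariant_left)).eventually
    (eventually_injective_isClosed_range hi hM.1.1)
  have hind := (tendsto_sub_smul_one S).eventually hS.eventually_ind_eq
  have hfreq := h.frequently_hasIndexIn hM hN
  constructor
  · obtain ⟨w, hw, hw'⟩ := (hfreq.and_eventually hind).exists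
    exact ⟨hS, hw'.2 ▸ hw.2.2⟩
  · refine hS.ascent_lt_top_of_frequently ((hfreq.and_eventually hinj).mono fun w hw ↦ ?_)
    exact ascent_lt_top_of_injective ((h.sub_smul_one w).injective hw.2.1 hw.1.1.1)

/-- The finite-dimensional summand of the left part is absorbed into the zeroloid part. -/
theorem IsRed.isGzInvertibleIn (h : IsRed S M N) (hM : IsBrowderIn J (S.restrict h.invariant_left))
    (hN : IsZeroloid (S.restrict h.invariant_right)) : IsGzInvertibleIn J S := by
  have := h.isClosed_left.completeSpace_coe
  obtain ⟨P, Q, hred, hi, hfin⟩ := hM.1.1.exists_isRed_of_ascent_lt_top hM.2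
  have hsim := (Similar.prodMap_assoc _ _ (S.restrict h.invariant_right)).symm.trans <|
    (hred.similar_prodMap.prodMap (Similar.refl _)).trans h.similar_prodMap
  obtain ⟨M', N', h', hA, hB⟩ := hsim.exists_isRed
  refine ⟨M', N', h', ?_, ?_, ?_⟩
  · exact hA.hasIndexIn ((hred.hasIndexIn_iff hasIndexIn_zero_of_finiteDimensional).1 hM.1)
  · rw [← nullity_eq_zero, hA.nullity_eq, nullity_eq_zero]
    exact hi
  · exact hB.isZeroloid (isZeroloid_of_finiteDimensional.prodMap hN)

theorem spectrumOf_hasIndexIn_eq_iff (hJ : J' ⊆ J) :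
    spectrumOf (HasIndexIn J) T = spectrumOf (IsBrowderIn J') T ↔
      spectrumOf (HasGzIndexIn J) T = spectrumOf (IsGzInvertibleIn J') T := by
  rw [spectrumOf_eq_iff, spectrumOf_eq_iff]
  refine ⟨fun hT z ↦ ⟨?_, fun h ↦ h.hasGzIndexIn hJ⟩, fun hT z ↦ ⟨fun h ↦ ?_, fun h ↦ h.1.mono hJ⟩⟩
  · rintro ⟨M, N, h, hM, hN⟩
    have := h.isClosed_left.completeSpace_coe
    have hBrowder (w : ℂ) (hw : HasIndexIn J (T - z • (1 : X →L[ℂ] X) - w • (1 : X →L[ℂ] X))) :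
        IsBrowderIn J' (T - z • (1 : X →L[ℂ] X) - w • (1 : X →L[ℂ] X)) := by
      rw [sub_sub, ← add_smul] at hw ⊢
      exact (hT _).1 hw
    have hfreq := h.frequently_hasIndexIn (J := J ∩ {ind _}) ⟨hM.1, hM.2, rfl⟩ hN
    refine h.isGzInvertibleIn ⟨⟨hM.1, ?_⟩, ?_⟩ hN
    · obtain ⟨w, -, hw⟩ := hfreq.exists
      rw [← show ind _ = ind _ from hw.2.2]
      exact (hBrowder w (hw.mono Set.inter_subset_left)).1.2
    · refine hM.1.ascent_lt_top_of_frequently (hfreq.mono fun w hw ↦ ?_)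
      exact ascent_restrict_lt_top (hBrowder w (hw.2.mono Set.inter_subset_left)).2
        (h.sub_smul_one w).invariant_left
  · exact ((hT z).1 h.hasGzIndexIn).isBrowderIn h.1

end GeneralizedClasses

section Identifications

variable {X : Type*} [NormedAddCommGroup X] [NormedSpace ℂ X] {S : X →L[ℂ] X}

lemma isBoundedBelow_iff : IsBoundedBelow S ↔ HasIndexIn (Set.Iic 0) S ∧ Function.Injective S := by
  rw [IsBoundedBelow, nullity_eq_zero]
  exact ⟨fun h ↦ ⟨⟨h.1, ind_nonpos_of_injective h.2⟩, h.2⟩, fun h ↦ ⟨h.1.1, h.2⟩⟩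

lemma isSemiRegular_of_injective (hS : IsClosed (S.range : Set X)) (hi : Function.Injective S) :
    IsSemiRegular S := by
  refine ⟨hS, fun n ↦ ?_⟩
  rw [LinearMap.ker_eq_bot.2 hi]
  exact bot_le

lemma isUpperSemiFredholm_of_ind_nonpos (h : IsSemiFredholm S) (hi : ind S ≤ 0) :
    IsUpperSemiFredholm S := by
  refine h.elim id fun h ↦ ⟨h.1, lt_of_le_of_lt ?_ h.2⟩
  rwa [ind, EReal.sub_nonpos, EReal.coe_ennreal_le_coe_ennreal_iff, ENat.toENNReal_le] at hi

lemma isFredholm_iff [CompleteSpace X] : S.IsFredholm ↔ HasIndexIn {⊥}ᶜ S := by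
  rw [HasIndexIn, Set.mem_compl_singleton_iff, ind_ne_bot_iff]
  constructor
  · intro h
    exact ⟨⟨h.isClosed_range, nullity_lt_top.2 h.finite_ker⟩, codim_lt_top.2 h.finite_coker⟩
  · rintro ⟨⟨hc, hk⟩, hd⟩
    have := nullity_lt_top.1 hk
    exact
      { isStrictMap := (Topology.IsEmbedding.subtypeVal.isStrictMap_iff (f := S.rangeRestrict)).1
          (isQuotientMap_rangeRestrict hc).isStrictMap
        isClosed_range := hc
        finite_ker := this
        finite_coker := codim_lt_top.1 hd
        closedComplemented_ker := .of_finiteDimensional _ }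

lemma singleton_zero_subset_compl_bot : ({0} : Set EReal) ⊆ {⊥}ᶜ := by
  rw [Set.singleton_subset_iff]
  exact EReal.zero_ne_bot

lemma surjective_of_hasIndexIn_zero (h : HasIndexIn {0} S) (hi : Function.Injective S) :
    Function.Surjective S := by
  rw [← defect_eq_zero, ← (hasIndexIn_zero_iff.1 h).2, nullity_eq_zero]
  exact hi

lemma isUpperSemiGzWeyl_iff : IsUpperSemiGzWeyl S ↔ HasGzIndexIn (Set.Iic 0) S := by
  constructor
  · rintro ⟨-, _, ⟨M, N, h, hS, hN, rfl⟩, hi⟩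
    exact ⟨M, N, h, ⟨isUpperSemiFredholm_of_ind_nonpos hS hi, hi⟩, hN⟩
  · rintro ⟨M, N, h, hM, hN⟩
    exact ⟨⟨M, N, h, hM.1, hN⟩, _, ⟨M, N, h, .inl hM.1, hN, rfl⟩, hM.2⟩

lemma isLeftGzInvertible_iff : IsLeftGzInvertible S ↔ IsGzInvertibleIn (Set.Iic 0) S := by
  constructor
  · rintro ⟨M, N, h, hM⟩
    obtain ⟨hM, hi⟩ := isBoundedBelow_iff.1 hM
    exact ⟨M, N, h.toIsRed, hM, hi, h.zeroloid_right⟩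
  · rintro ⟨M, N, h, hM, hi, hN⟩
    exact ⟨M, N, ⟨h, isSemiRegular_of_injective hM.1.1 hi, hN⟩, isBoundedBelow_iff.2 ⟨hM, hi⟩⟩

variable [CompleteSpace X]

lemma isWeyl_iff : IsWeyl S ↔ HasIndexIn {0} S := by
  rw [IsWeyl, isFredholm_iff]
  exact ⟨fun h ↦ ⟨h.1.1, h.2⟩, fun h ↦ ⟨h.mono singleton_zero_subset_compl_bot, h.2⟩⟩

lemma isBrowder_iff : IsBrowder S ↔ IsBrowderIn {0} S := by
  rw [IsBrowder, isFredholm_iff]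
  constructor
  · rintro ⟨hS, ha, hd⟩
    obtain ⟨M, N, h, hi, _⟩ := hS.1.exists_isRed_of_ascent_lt_top ha
    refine ⟨(h.hasIndexIn_iff hasIndexIn_zero_of_finiteDimensional).2 ?_, ha⟩
    exact hasIndexIn_zero_of_bijective ⟨hi, h.surjective_restrict_of_descent_lt_top hi hd⟩
  · rintro ⟨hS, ha⟩
    obtain ⟨M, N, h, hi, _⟩ := hS.1.exists_isRed_of_ascent_lt_top ha
    have hM := (h.hasIndexIn_iff hasIndexIn_zero_of_finiteDimensional).1 hS
    exact ⟨hS.mono singleton_zero_subset_compl_bot, ha,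
      h.descent_lt_top_of_surjective_restrict (surjective_of_hasIndexIn_zero hM hi)⟩

lemma isUpperSemiBrowder_iff : IsUpperSemiBrowder S ↔ IsBrowderIn (Set.Iic 0) S :=
  ⟨fun h ↦ ⟨⟨h.1, h.1.ind_nonpos_of_ascent_lt_top h.2⟩, h.2⟩, fun h ↦ ⟨h.1.1, h.2⟩⟩

lemma isGzFredholm_iff : IsGzFredholm S ↔ HasGzIndexIn {⊥}ᶜ S := by
  refine exists₃_congr fun M N h ↦ and_congr_left' ?_
  have := h.isClosed_left.completeSpace_coe
  exact isFredholm_iff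

lemma isGzWeyl_iff : IsGzWeyl S ↔ HasGzIndexIn {0} S := by
  constructor
  · rintro ⟨-, M, N, h, hS, hN, hi⟩
    exact ⟨M, N, h, ⟨isUpperSemiFredholm_of_ind_nonpos hS hi.le, hi⟩, hN⟩
  · rintro ⟨M, N, h, hM, hN⟩
    exact ⟨isGzFredholm_iff.2 ⟨M, N, h, hM.mono singleton_zero_subset_compl_bot, hN⟩,
      M, N, h, .inl hM.1, hN, hM.2⟩

/-- For a common small `w` outside the spectra of both zeroloid parts, `S - w` is bijective; hence
the left parts of `S - w` and of `S` have index zero. -/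
lemma IsRed.hasIndexIn_zero_of_surjective {M N M' N' : Submodule ℂ X} (h : IsRed S M N)
    (h' : IsRed S M' N') (hM : IsUpperSemiFredholm (S.restrict h.invariant_left))
    (hi : Function.Injective (S.restrict h.invariant_left))
    (hN : IsZeroloid (S.restrict h.invariant_right))
    (hs : Function.Surjective (S.restrict h'.invariant_left))
    (hN' : IsZeroloid (S.restrict h'.invariant_right)) :
    HasIndexIn {0} (S.restrict h.invariant_left) := by
  have := h.isClosed_left.completeSpace_coe
  have := h'.isClosed_left.completeSpace_coe
  have := h.isClosed_right.completeSpace_coe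
  have := h'.isClosed_right.completeSpace_coe
  have hfreq := frequently_notMem_of_derivedSet_subset <|
    (derivedSet_union _ _).trans_subset (Set.union_subset hN hN')
  have hleft := (tendsto_sub_smul_one (S.restrict h.invariant_left)).eventually
    ((eventually_injective_isClosed_range hi hM.1).and hM.eventually_ind_eq)
  have hright := (tendsto_sub_smul_one (S.restrict h'.invariant_left)).eventually
    (eventually_surjective hs)
  obtain ⟨w, hw, ⟨⟨hi, -⟩, -, hind⟩, hs⟩ := (hfreq.and_eventually (hleft.and hright)).exists
  rw [Set.mem_union, not_or] at hw
  have hbN := bijective_sub_smul_one_of_notMem_spectrum hw.1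
  have hbN' := bijective_sub_smul_one_of_notMem_spectrum hw.2
  have hbij : Function.Bijective (S - w • (1 : X →L[ℂ] X)) :=
    ⟨(h.sub_smul_one w).injective hi hbN.1, (h'.sub_smul_one w).surjective hs hbN'.2⟩
  have h₀ := ((h.sub_smul_one w).hasIndexIn_iff (hasIndexIn_zero_of_bijective hbN)).1
    (hasIndexIn_zero_of_bijective hbij)
  exact ⟨hM, hind.symm.trans h₀.2⟩

lemma isGzInvertible_iff : IsGzInvertible S ↔ IsGzInvertibleIn {0} S := by
  constructor
  · rintro ⟨⟨M, N, h, hM⟩, M', N', h', hs⟩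
    obtain ⟨hM, hi⟩ := isBoundedBelow_iff.1 hM
    exact ⟨M, N, h.toIsRed, h.hasIndexIn_zero_of_surjective h'.toIsRed hM.1 hi h.zeroloid_right hs
      h'.zeroloid_right, hi, h.zeroloid_right⟩
  · rintro ⟨M, N, h, hM, hi, hN⟩
    have hKD : IsGzKD S M N := ⟨h, isSemiRegular_of_injective hM.1.1 hi, hN⟩
    exact ⟨isLeftGzInvertible_iff.2 ⟨M, N, h, hM.mono (by simp), hi, hN⟩, M, N, hKD,
      surjective_of_hasIndexIn_zero hM hi⟩

end Identifications

end GzSpectral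

theorem theorem4p1 {X : Type*} [NormedAddCommGroup X] [NormedSpace ℂ X] [CompleteSpace X]
    (T : X →L[ℂ] X) :
    (SatisfiesBrowder T ↔ spectrumOf IsGzWeyl T = spectrumOf IsGzInvertible T) ∧
    (SatisfiesEssentialBrowder T ↔ spectrumOf IsGzFredholm T = spectrumOf IsGzInvertible T) ∧
    (SatisfiesABrowder T ↔ spectrumOf IsUpperSemiGzWeyl T = spectrumOf IsLeftGzInvertible T) := by
  have h₁ := spectrumOf_hasIndexIn_eq_iff (T := T) (subset_refl {0})
  have h₂ := spectrumOf_hasIndexIn_eq_iff (T := T) singleton_zero_subset_compl_bot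
  have h₃ := spectrumOf_hasIndexIn_eq_iff (T := T) (subset_refl (Set.Iic 0))
  simp only [SatisfiesBrowder, SatisfiesEssentialBrowder, SatisfiesABrowder, spectrumOf, isWeyl_iff,
    isBrowder_iff, isFredholm_iff, isUpperSemiBrowder_iff, isGzWeyl_iff, isGzFredholm_iff,
    isUpperSemiGzWeyl_iff, isGzInvertible_iff, isLeftGzInvertible_iff] at h₁ h₂ h₃ ⊢
  exact ⟨h₁, h₂, h₃⟩
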